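/- Let $\mathcal{R}$ be a finite (not necessarily commutative) chain ring, i.e. a finite ring whose left ideals are totally ordered by inclusion, with maximal ideal $\langle\pi\rangle$, let $q=|\mathcal{R}/\langle\pi\rangle|$ be the size of its residue field and let $s$ be its nilpotency index, the smallest positive integer with $\pi^s=0$. A finite left $\mathcal{R}$-module $M$ has rank $K$ if $M\cong\bigoplus_{i=1}^K \mathcal{R}/\langle\pi^{\lambda_i}\rangle$ with $s\ge\lambda_1\geq\cdots\geq\lambda_K>0$. For $|x|<1$ put $(x)_r=\prod_{i=1}^r(1-x^i)$ and $$AGI(x,s)=\sum_{n_1,\ldots,n_{s-1}\ge 0}\frac{x^{N_1^2+\cdots+N_{s-1}^2}}{(x)_{n_1}\cdots(x)_{n_{s-1}}},\qquad N_i=n_i+\cdots+n_{s-1}.$$ Let $R'$ be a fixed rational number with $0<R'\le 1/2$. Then the series $AGI(1/q,s)$ converges. Moreover, as $n\to\infty$ through the positive integers for which $K=R'n$ is an integer, the ratio $$\frac{|\{N\le\mathcal{R}^n \text{ a free submodule of rank } K\}|}{|\{N\le\mathcal{R}^n \text{ a submodule of rank } K\}|}$$ (where submodules are left submodules) has a limit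 $d$, the density of the free submodules among the submodules of $\mathcal{R}^n$ of rank $K$, and $$d\ \ge\ AGI(1/q,s)^{-1}.$$ If moreover $R'<1/2$, then $d=1$. -/

import Mathlib

open Filter Topology

/-- The left ideals of `R` form a chain under inclusion (`Ideal R` is the type of left ideals).
A finite ring has this property if and only if its right ideals form a chain. -/
def IsChainRing (R : Type*) [Ring R] : Prop :=
  ∀ I J : Ideal R, I ≤ J ∨ J ≤ I

/-- The left module `M` over a chain ring with maximal ideal `⟨π⟩` has type
`lam = (lam 0 ≥ lam 1 ≥ ⋯ ≥ lam (K - 1) > 0)`, i.e. `M ≅ ⨁ i, R / ⟨π ^ lam i⟩`, where the parts are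
bounded by the nilpotency index of `π`. -/
def HasModuleType {R : Type*} [Ring R] (π : R) (M : Type*) [AddCommGroup M] [Module R M]
    {K : ℕ} (lam : Fin K → ℕ) : Prop :=
  Antitone lam ∧ (∀ i, 0 < lam i ∧ lam i ≤ nilpotencyClass π) ∧
    Nonempty (M ≃ₗ[R] ((i : Fin K) → R ⧸ Ideal.span {π ^ lam i}))

/-- The rank of a module is the number of parts of its type. -/
def HasModuleRank {R : Type*} [Ring R] (π : R) (M : Type*) [AddCommGroup M] [Module R M]
    (K : ℕ) : Prop :=
  ∃ lam : Fin K → ℕ, HasModuleType π M lam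

/-- The set of (left) submodules of `R ^ n` of rank `K`. -/
def rankSubmodules {R : Type*} [Ring R] (π : R) (n K : ℕ) : Set (Submodule R (Fin n → R)) :=
  {N | HasModuleRank π N K}

/-- The set of free (left) submodules of `R ^ n` of rank `K`. -/
def freeRankSubmodules {R : Type*} [Ring R] (π : R) (n K : ℕ) :
    Set (Submodule R (Fin n → R)) :=
  {N | N ∈ rankSubmodules π n K ∧ Module.Free R N}

/-- The proportion of free submodules among the submodules of `R ^ n` of rank `K`. -/
noncomputable def freeProportion {R : Type*} [Ring R] (π : R) (n K : ℕ) : ℝ :=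
  ((freeRankSubmodules π n K).ncard : ℝ) / ((rankSubmodules π n K).ncard : ℝ)

/-- The `q`-Pochhammer symbol `(a; q)_r`. -/
noncomputable def qPochhammer (a q : ℝ) (r : ℕ) : ℝ :=
  ∏ i ∈ Finset.range r, (1 - a * q ^ i)

/-- The term `q ^ (N_1 ^ 2 + ⋯ + N_{s-1} ^ 2) / ((q)_{n_1} ⋯ (q)_{n_{s-1}})` of the Andrews-Gordon
series, where `N_i = n_i + ⋯ + n_{s-1}`. -/
noncomputable def agiTerm (q : ℝ) (s : ℕ) (n : Fin (s - 1) → ℕ) : ℝ :=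
  q ^ (∑ i, (∑ j ∈ Finset.Ici i, n j) ^ 2) / ∏ i, qPochhammer q q (n i)

/-- The sum `AGI(q, s)` of the Andrews-Gordon series. -/
noncomputable def AGI (q : ℝ) (s : ℕ) : ℝ :=
  ∑' n : Fin (s - 1) → ℕ, agiTerm q s n

/-! Write `x = 1/q` and `n = 2K + d`. Submodules of type `lam` are counted by double counting tuples
`v` with `TypeIndependent π lam v`: such tuples in `R ^ n` are grouped by their span, and every span
of that type carries the same number of them. The tuples are counted one vector at a time
(`card_extension`, `card_typeIndependent`), using only the orders of annihilators of powers of `π`.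

Dividing the count for `lam` by the count for the free type cancels a product that depends only on
`n` and `K`. What remains is `typeWeight x s K d m`, with `m` the multiplicities of the parts below
`s` (`ncard_typeSubmodules_eq`); the power of `q` comes from `exponent_identity`. Types correspond
bijectively to vectors `m` with sum at most `K`, so the proportion of free submodules is the inverse
of the sum of these weights.

Each weight is the Andrews-Gordon term times two factors in `[0, 1]`: a power of `x` whose exponent
is a multiple of `d`, and a quotient of Pochhammer symbols tending to 1 (`typeWeight_eq`). The
Andrews-Gordon series is summable because `x ≤ 1/2`, so dominated convergence applies. If `R' =
1/2`, then `d = 0` and the sum tends to `AGI`, so the limiting density is exactly its inverse. If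
`R' < 1/2`, then `d → ∞` and only `m = 0` survives, so the density is 1. -/

theorem Ideal.not_isUnit_of_mem_maximal {R : Type*} [Ring R] {π : R}
    (hπ : (Ideal.span {π}).IsMaximal) {a : R} (ha : a ∈ Ideal.span {π}) : ¬ IsUnit a :=
  fun h => hπ.ne_top (Ideal.eq_top_of_isUnit_mem _ ha h)

theorem Ideal.span_pow_singleton_anti {R : Type*} [Ring R] (π : R) {i j : ℕ}
    (h : i ≤ j) : Ideal.span {π ^ j} ≤ Ideal.span {π ^ i} := by
  rw [Ideal.span_singleton_le_iff_mem]
  exact Ideal.mem_span_singleton'.2 ⟨π ^ (j - i), by rw [← pow_add, Nat.sub_add_cancel h]⟩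

/-! ### Orders of images, kernels and annihilators. -/

theorem AddSubgroup.card_map_mul_card_inf_ker {G H : Type*} [AddCommGroup G]
    [AddCommGroup H] (f : G →+ H) (A : AddSubgroup G) :
    Nat.card (A.map f) * Nat.card (A ⊓ f.ker : AddSubgroup G) = Nat.card A := by
  have h1 := AddSubgroup.card_eq_card_quotient_mul_card_addSubgroup (f.comp A.subtype).ker
  rw [h1]
  congr 1
  · rw [Nat.card_congr (QuotientAddGroup.quotientKerEquivRange (f.comp A.subtype)).toEquiv,
      AddMonoidHom.range_comp, AddSubgroup.range_subtype]
  · rw [← AddSubgroup.card_map_of_injective (f := A.subtype) (K := (f.comp A.subtype).ker)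
      A.subtype_injective]
    congr 2
    ext x
    simp [AddSubgroup.mem_map, AddMonoidHom.mem_ker, and_comm]

/-- The elements of the module `M` that are annihilated by the ring element `a`. -/
def annihilatedBy {R : Type*} [Ring R] (a : R) (M : Type*) [AddCommGroup M] [Module R M] :
    AddSubgroup M :=
  (DistribSMul.toAddMonoidHom M a).ker

theorem mem_annihilatedBy {R : Type*} [Ring R] {a : R} {M : Type*} [AddCommGroup M] [Module R M]
    {x : M} : x ∈ annihilatedBy a M ↔ a • x = 0 :=
  AddMonoidHom.mem_ker

theorem card_annihilatedBy_congr {R : Type*} [Ring R] (a : R) {M N : Type*} [AddCommGroup M]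
    [Module R M] [AddCommGroup N] [Module R N] (e : M ≃ₗ[R] N) :
    Nat.card (annihilatedBy a M) = Nat.card (annihilatedBy a N) := by
  refine Nat.card_congr (e.toEquiv.subtypeEquiv fun x => ?_)
  rw [mem_annihilatedBy, mem_annihilatedBy]
  change _ ↔ a • e x = 0
  rw [← map_smul, LinearEquiv.map_eq_zero_iff]

theorem card_annihilatedBy_pi {R : Type*} [Ring R] (a : R) {ι : Type*} [Fintype ι] (M : ι → Type*)
    [∀ i, AddCommGroup (M i)] [∀ i, Module R (M i)] :
    Nat.card (annihilatedBy a (∀ i, M i)) = ∏ i, Nat.card (annihilatedBy a (M i)) := by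
  rw [← Nat.card_pi]
  refine Nat.card_congr (Equiv.trans (Equiv.subtypeEquivRight fun x => ?_)
    (Equiv.subtypePiEquivPi (p := fun i (y : M i) => y ∈ annihilatedBy a (M i))))
  simp only [mem_annihilatedBy, funext_iff, Pi.smul_apply, Pi.zero_apply]

/-! ### Arithmetic of a finite chain ring. -/

namespace IsChainRing

variable {R : Type*} [Ring R] [Finite R] {π : R}

/-- By the chain condition `Ra` strictly contains the maximal ideal, hence is everything. The
resulting left inverse is two-sided because the ring is finite. -/
theorem isUnit_of_notMem (hR : IsChainRing R) (hπ : (Ideal.span {π}).IsMaximal) {a : R}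
    (ha : a ∉ Ideal.span {π}) : IsUnit a := by
  have h1 : Ideal.span {π} < Ideal.span {a} := by
    rcases hR (Ideal.span {π}) (Ideal.span {a}) with h | h
    · refine lt_of_le_of_ne h fun h' => ha ?_
      rw [h']; exact Ideal.mem_span_singleton_self a
    · exact absurd (h (Ideal.mem_span_singleton_self a)) ha
  have h2 := hπ.out.2 _ h1
  have h3 : (1 : R) ∈ Ideal.span {a} := by rw [h2]; trivial
  obtain ⟨b, hb⟩ := Ideal.mem_span_singleton'.1 h3
  exact IsUnit.of_mul_eq_one_right b hb

theorem isUnit_one_sub (hR : IsChainRing R) (hπ : (Ideal.span {π}).IsMaximal) {a : R}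
    (ha : a ∈ Ideal.span {π}) : IsUnit (1 - a) := by
  refine isUnit_of_notMem hR hπ fun h => Ideal.not_isUnit_of_mem_maximal hπ ?_ isUnit_one
  simpa using add_mem h ha

theorem isNilpotent_generator (hR : IsChainRing R) (hπ : (Ideal.span {π}).IsMaximal) :
    IsNilpotent π := by
  -- Two powers coincide by finiteness; their difference is a unit `1 - π ^ (b - a)` times `π ^ a`.
  obtain ⟨a, b, hab, h⟩ := Finite.exists_ne_map_eq_of_infinite (fun k : ℕ => π ^ k)
  wlog hlt : a < b generalizing a b
  · exact this b a hab.symm h.symm (by omega)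
  refine ⟨a, ?_⟩
  have h1 : IsUnit (1 - π ^ (b - a)) := by
    refine isUnit_one_sub hR hπ (Ideal.mem_span_singleton'.2 ⟨π ^ (b - a - 1), ?_⟩)
    rw [← pow_succ]; congr 1; omega
  have h2 : (1 - π ^ (b - a)) * π ^ a = 0 := by
    rw [sub_mul, one_mul, ← pow_add, Nat.sub_add_cancel hlt.le, sub_eq_zero]; exact h
  exact (h1.mul_right_eq_zero).1 h2

theorem generator_pow_eq_zero_iff (hR : IsChainRing R) (hπ : (Ideal.span {π}).IsMaximal) {k : ℕ} :
    π ^ k = 0 ↔ nilpotencyClass π ≤ k :=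
  ⟨fun h => Nat.sInf_le h, fun h =>
    pow_eq_zero_of_le h (pow_nilpotencyClass (isNilpotent_generator hR hπ))⟩

theorem nilpotencyClass_generator_pos (hR : IsChainRing R) (hπ : (Ideal.span {π}).IsMaximal) :
    0 < nilpotencyClass π := by
  by_contra h
  have h0 := (generator_pow_eq_zero_iff hR hπ (k := 0)).2 (by omega)
  rw [pow_zero] at h0
  have := subsingleton_of_zero_eq_one h0.symm
  exact hπ.ne_top (Subsingleton.elim _ _)

theorem unit_mul_pow_mem_iff (hR : IsChainRing R) (hπ : (Ideal.span {π}).IsMaximal) {u : R}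
    (hu : IsUnit u) {i l : ℕ} (hl : l ≤ nilpotencyClass π) :
    u * π ^ i ∈ Ideal.span {π ^ l} ↔ l ≤ i := by
  rw [Ideal.mem_span_singleton']
  constructor
  · rintro ⟨a, ha⟩
    by_contra! hi
    obtain ⟨u, rfl⟩ := hu
    have h1 : (1 - (↑u⁻¹ * a * π ^ (l - i - 1)) * π) * π ^ i = 0 := by
      rw [sub_mul, one_mul, sub_eq_zero, mul_assoc, mul_assoc, mul_assoc, ← pow_succ', ← pow_add,
        show l - i - 1 + (i + 1) = l by omega, ha, Units.inv_mul_cancel_left]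
    have h2 := (isUnit_one_sub hR hπ (Ideal.mem_span_singleton'.2 ⟨_, rfl⟩)).mul_right_eq_zero.1 h1
    have := (generator_pow_eq_zero_iff hR hπ).1 h2
    omega
  · intro h
    refine ⟨u * π ^ (i - l), ?_⟩
    rw [mul_assoc, ← pow_add, Nat.sub_add_cancel h]

/-- Take the last `k` with `a` in the left ideal of `π ^ k`. The cofactor cannot lie in the maximal
ideal, so it is a unit. -/
theorem exists_eq_unit_mul_pow (hR : IsChainRing R) (hπ : (Ideal.span {π}).IsMaximal) {a : R}
    (ha : a ≠ 0) : ∃ u : R, ∃ k : ℕ, IsUnit u ∧ a = u * π ^ k := by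
  classical
  have hex : ∃ k, a ∉ Ideal.span {π ^ k} := by
    refine ⟨nilpotencyClass π, ?_⟩
    rw [(generator_pow_eq_zero_iff hR hπ).2 le_rfl]
    simpa [Ideal.mem_span_singleton'] using ha
  have h1 := Nat.find_spec hex
  rcases hk : Nat.find hex with _ | k
  · rw [hk] at h1
    exact absurd (by simp) h1
  · rw [hk] at h1
    have h2 : a ∈ Ideal.span {π ^ k} := by
      by_contra h
      have := Nat.find_min' hex h
      omega
    obtain ⟨u, hu⟩ := Ideal.mem_span_singleton'.1 h2
    refine ⟨u, k, isUnit_of_notMem hR hπ fun h => h1 ?_, hu.symm⟩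
    obtain ⟨b, rfl⟩ := Ideal.mem_span_singleton'.1 h
    exact Ideal.mem_span_singleton'.2 ⟨b, by rw [← hu, mul_assoc, pow_succ']⟩

/-- Replaces commutativity: `π` can be moved past any element. Otherwise `π * a` would be a unit,
giving `π` a right inverse. -/
theorem exists_generator_mul_eq (hR : IsChainRing R) (hπ : (Ideal.span {π}).IsMaximal) (a : R) :
    ∃ b, π * a = b * π := by
  by_cases h : π * a ∈ Ideal.span {π}
  · obtain ⟨b, hb⟩ := Ideal.mem_span_singleton'.1 h
    exact ⟨b, hb.symm⟩
  · obtain ⟨u, hu⟩ := isUnit_of_notMem hR hπ h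
    refine absurd ?_ (Ideal.not_isUnit_of_mem_maximal hπ (Ideal.mem_span_singleton_self π))
    exact IsUnit.of_mul_eq_one (a * ↑u⁻¹) (by rw [← mul_assoc, ← hu, Units.mul_inv])

theorem exists_pow_mul_eq (hR : IsChainRing R) (hπ : (Ideal.span {π}).IsMaximal) (k : ℕ) (a : R) :
    ∃ b, π ^ k * a = b * π ^ k := by
  induction k generalizing a with
  | zero => exact ⟨a, by simp⟩
  | succ k ih =>
    obtain ⟨b, hb⟩ := exists_generator_mul_eq hR hπ a
    obtain ⟨c, hc⟩ := ih b
    exact ⟨c, by rw [pow_succ, mul_assoc, hb, ← mul_assoc, hc, mul_assoc]⟩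

theorem exists_unit_generator_mul_eq (hR : IsChainRing R) (hπ : (Ideal.span {π}).IsMaximal) {u : R}
    (hu : IsUnit u) : ∃ v, IsUnit v ∧ π * u = v * π := by
  by_cases h0 : π = 0
  · exact ⟨1, isUnit_one, by simp [h0]⟩
  obtain ⟨v, hv⟩ := exists_generator_mul_eq hR hπ u
  refine ⟨v, isUnit_of_notMem hR hπ fun h => h0 ?_, hv⟩
  obtain ⟨b, rfl⟩ := Ideal.mem_span_singleton'.1 h
  obtain ⟨u, rfl⟩ := hu
  obtain ⟨c, hc⟩ := exists_pow_mul_eq hR hπ 2 (↑u⁻¹ : R)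
  -- If the new cofactor were `b * π`, then cancelling `u` would give `π = b * c * π ^ 2`, hence `π
  -- = 0`.
  have h1 : (1 - (b * c * π)) * π = 0 := by
    rw [sub_mul, one_mul, sub_eq_zero]
    calc π = π * u * ↑u⁻¹ := by rw [Units.mul_inv_cancel_right]
      _ = b * (π ^ 2 * ↑u⁻¹) := by rw [hv]; simp only [pow_two, mul_assoc]
      _ = _ := by rw [hc]; simp only [pow_two, mul_assoc]
  exact (isUnit_one_sub hR hπ (Ideal.mem_span_singleton'.2 ⟨_, rfl⟩)).mul_right_eq_zero.1 h1

theorem exists_unit_pow_mul_eq (hR : IsChainRing R) (hπ : (Ideal.span {π}).IsMaximal) (k : ℕ)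
    {u : R} (hu : IsUnit u) : ∃ v, IsUnit v ∧ π ^ k * u = v * π ^ k := by
  induction k generalizing u with
  | zero => exact ⟨u, hu, by simp⟩
  | succ k ih =>
    obtain ⟨b, hbu, hb⟩ := exists_unit_generator_mul_eq hR hπ hu
    obtain ⟨c, hcu, hc⟩ := ih hbu
    exact ⟨c, hcu, by rw [pow_succ, mul_assoc, hb, ← mul_assoc, hc, mul_assoc]⟩

theorem pow_mul_mem_iff (hR : IsChainRing R) (hπ : (Ideal.span {π}).IsMaximal) {k l : ℕ}
    (hl : l ≤ nilpotencyClass π) (a : R) :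
    π ^ k * a ∈ Ideal.span {π ^ l} ↔ a ∈ Ideal.span {π ^ (l - k)} := by
  by_cases ha : a = 0
  · simp [ha]
  obtain ⟨u, j, hu, rfl⟩ := exists_eq_unit_mul_pow hR hπ ha
  obtain ⟨v, hv, h⟩ := exists_unit_pow_mul_eq hR hπ k hu
  rw [← mul_assoc, h, mul_assoc, ← pow_add, unit_mul_pow_mem_iff hR hπ hv hl,
    unit_mul_pow_mem_iff hR hπ hu (by omega)]
  omega

theorem mul_generator_eq_zero_iff (hR : IsChainRing R) (hπ : (Ideal.span {π}).IsMaximal) (a : R) :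
    a * π = 0 ↔ a ∈ Ideal.span {π ^ (nilpotencyClass π - 1)} := by
  by_cases ha : a = 0
  · simp [ha]
  obtain ⟨u, j, hu, rfl⟩ := exists_eq_unit_mul_pow hR hπ ha
  rw [mul_assoc, ← pow_succ, unit_mul_pow_mem_iff hR hπ hu (by omega), hu.mul_right_eq_zero,
    generator_pow_eq_zero_iff hR hπ]
  omega

/-- Right multiplication by `π` maps `Rπ^j` onto `Rπ^(j+1)` with kernel `Rπ^(s-1)` for every `j <
s`. All successive indices are therefore equal, and `j = 0` identifies them with `q`. -/
theorem card_span_pow (hR : IsChainRing R) (hπ : (Ideal.span {π}).IsMaximal) {j : ℕ}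
    (hj : j ≤ nilpotencyClass π) :
    Nat.card (Ideal.span {π ^ j}) =
      Nat.card (R ⧸ Ideal.span {π}) ^ (nilpotencyClass π - j) := by
  set s := nilpotencyClass π with hs
  have hs0 : 0 < s := nilpotencyClass_generator_pos hR hπ
  have key : ∀ j < s, Nat.card (Ideal.span {π ^ j}) =
      Nat.card (Ideal.span {π ^ (s - 1)}) * Nat.card (Ideal.span {π ^ (j + 1)}) := by
    intro j hj
    have h := AddSubgroup.card_map_mul_card_inf_ker (AddMonoidHom.mulRight π)
      (Ideal.span {π ^ j}).toAddSubgroup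
    have h1 : (Ideal.span {π ^ j}).toAddSubgroup.map (AddMonoidHom.mulRight π) =
        (Ideal.span {π ^ (j + 1)}).toAddSubgroup := by
      ext x
      simp only [AddSubgroup.mem_map, Submodule.mem_toAddSubgroup, Ideal.mem_span_singleton',
        AddMonoidHom.coe_mulRight]
      constructor
      · rintro ⟨_, ⟨a, rfl⟩, rfl⟩
        exact ⟨a, by rw [mul_assoc, pow_succ]⟩
      · rintro ⟨a, rfl⟩
        exact ⟨_, ⟨a, rfl⟩, by rw [mul_assoc, pow_succ]⟩
    have h2 : (Ideal.span {π ^ j}).toAddSubgroup ⊓ (AddMonoidHom.mulRight π).ker =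
        (Ideal.span {π ^ (s - 1)}).toAddSubgroup := by
      ext x
      simp only [AddSubgroup.mem_inf, Submodule.mem_toAddSubgroup, AddMonoidHom.mem_ker,
        AddMonoidHom.coe_mulRight, mul_generator_eq_zero_iff hR hπ]
      exact ⟨fun h => h.2, fun h => ⟨Ideal.span_pow_singleton_anti π (by omega) h, h⟩⟩
    rw [h1, h2] at h
    rw [mul_comm]
    exact h.symm
  have hq : Nat.card (Ideal.span {π ^ (s - 1)}) = Nat.card (R ⧸ Ideal.span {π}) := by
    have h1 := key 0 hs0
    have h2 := Submodule.card_eq_card_quotient_mul_card (Ideal.span {π})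
    have h3 : Nat.card (Ideal.span {π ^ 0}) = Nat.card R := by
      rw [pow_zero, Ideal.span_singleton_one]
      exact Nat.card_congr (Equiv.Set.univ R)
    rw [h3, h2, zero_add, pow_one] at h1
    have h4 : 0 < Nat.card (Ideal.span {π}) := Nat.card_pos
    exact (Nat.eq_of_mul_eq_mul_right h4 ((mul_comm _ _).trans h1)).symm
  induction hj using Nat.decreasingInduction with
  | self =>
    rw [(generator_pow_eq_zero_iff hR hπ).2 le_rfl]
    simp
  | of_succ k hk ih =>
    rw [key k hk, hq, ih, ← pow_succ']
    congr 1
    omega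

/-- The annihilated elements are the image of `Rπ^(l-k)`; truncated subtraction is what produces the
minimum. -/
theorem card_annihilatedBy_quotient (hR : IsChainRing R) (hπ : (Ideal.span {π}).IsMaximal)
    {l : ℕ} (hl : l ≤ nilpotencyClass π) (k : ℕ) :
    Nat.card (annihilatedBy (π ^ k) (R ⧸ Ideal.span {π ^ l})) =
      Nat.card (R ⧸ Ideal.span {π}) ^ (min l k) := by
  have h := AddSubgroup.card_map_mul_card_inf_ker
    (Ideal.span {π ^ l}).mkQ.toAddMonoidHom (Ideal.span {π ^ (l - k)}).toAddSubgroup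
  have h1 : (Ideal.span {π ^ (l - k)}).toAddSubgroup.map
      (Ideal.span {π ^ l}).mkQ.toAddMonoidHom =
        annihilatedBy (π ^ k) (R ⧸ Ideal.span {π ^ l}) := by
    ext x
    obtain ⟨a, rfl⟩ := Submodule.mkQ_surjective _ x
    rw [mem_annihilatedBy, ← map_smul, Submodule.mkQ_apply _ (_ • _),
      Submodule.Quotient.mk_eq_zero, smul_eq_mul, pow_mul_mem_iff hR hπ hl]
    simp only [AddSubgroup.mem_map, Submodule.mem_toAddSubgroup, LinearMap.toAddMonoidHom_coe]
    constructor
    · rintro ⟨b, hb, hba⟩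
      have : b - a ∈ Ideal.span {π ^ l} := (Submodule.Quotient.eq _).1 hba
      have := sub_mem hb (Ideal.span_pow_singleton_anti π (Nat.sub_le l k) this)
      simpa using this
    · intro ha
      exact ⟨a, ha, rfl⟩
  have h2 : (Ideal.span {π ^ (l - k)}).toAddSubgroup ⊓
      (Ideal.span {π ^ l}).mkQ.toAddMonoidHom.ker = (Ideal.span {π ^ l}).toAddSubgroup := by
    ext x
    simp only [AddSubgroup.mem_inf, Submodule.mem_toAddSubgroup, AddMonoidHom.mem_ker,
      LinearMap.toAddMonoidHom_coe, Submodule.mkQ_apply, Submodule.Quotient.mk_eq_zero]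
    exact ⟨fun h => h.2, fun h => ⟨Ideal.span_pow_singleton_anti π (Nat.sub_le l k) h, h⟩⟩
  have := Finite.of_surjective _ (Ideal.span {π}).mkQ_surjective
  have hq : 0 < Nat.card (R ⧸ Ideal.span {π}) := Nat.card_pos
  rw [h1, h2] at h
  have h3 : Nat.card (Ideal.span {π ^ l}).toAddSubgroup = _ := card_span_pow hR hπ hl
  have h4 : Nat.card (Ideal.span {π ^ (l - k)}).toAddSubgroup = _ :=
    card_span_pow hR hπ (j := l - k) (by omega)
  rw [h3, h4] at h
  refine Nat.eq_of_mul_eq_mul_right (pow_pos hq _) (h.trans ?_)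
  rw [← pow_add]
  congr 1
  omega

end IsChainRing

/-! ### Independent tuples of prescribed type. -/

/-- The tuple `v` generates a submodule that is the direct sum of cyclic submodules generated by the
`v i`, the annihilator of `v i` being the left ideal generated by `π ^ lam i`. -/
def TypeIndependent {R : Type*} [Ring R] (π : R) {M : Type*} [AddCommGroup M] [Module R M]
    {K : ℕ} (lam : Fin K → ℕ) (v : Fin K → M) : Prop :=
  ∀ r : Fin K → R, ∑ i, r i • v i = 0 ↔ ∀ i, r i ∈ Ideal.span {π ^ lam i}

section TypeIndependent

variable {R : Type*} [Ring R] {π : R} {M : Type*} [AddCommGroup M] [Module R M] {K : ℕ}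

theorem TypeIndependent.nonempty_span_equiv {lam : Fin K → ℕ} {v : Fin K → M}
    (h : TypeIndependent π lam v) :
    Nonempty (Submodule.span R (Set.range v) ≃ₗ[R]
      ((i : Fin K) → R ⧸ Ideal.span {π ^ lam i})) := by
  let φ : (Fin K → R) →ₗ[R] M := Fintype.linearCombination R v
  let ψ : (Fin K → R) →ₗ[R] ((i : Fin K) → R ⧸ Ideal.span {π ^ lam i}) :=
    LinearMap.pi fun i => (Ideal.span {π ^ lam i}).mkQ ∘ₗ LinearMap.proj i
  have hψ : Function.Surjective ψ := by
    intro y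
    choose r hr using fun i => (Ideal.span {π ^ lam i}).mkQ_surjective (y i)
    exact ⟨r, funext hr⟩
  have hker : LinearMap.ker φ = LinearMap.ker ψ := by
    ext r
    rw [LinearMap.mem_ker, LinearMap.mem_ker]
    refine (h r).trans ?_
    rw [funext_iff]
    exact forall_congr' fun i => (Submodule.Quotient.mk_eq_zero _).symm
  have hr : LinearMap.range φ = Submodule.span R (Set.range v) :=
    Fintype.range_linearCombination R v
  exact ⟨(LinearEquiv.ofEq _ _ hr).symm ≪≫ₗ φ.quotKerEquivRange.symm ≪≫ₗ
    Submodule.quotEquivOfEq _ _ hker ≪≫ₗ ψ.quotKerEquivOfSurjective hψ⟩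

theorem TypeIndependent.map_iff {N : Type*} [AddCommGroup N] [Module R N] {f : M →ₗ[R] N}
    (hf : Function.Injective f) {lam : Fin K → ℕ} {v : Fin K → M} :
    TypeIndependent π lam (fun i => f (v i)) ↔ TypeIndependent π lam v := by
  refine forall_congr' fun r => ?_
  have : ∑ i, r i • f (v i) = f (∑ i, r i • v i) := by simp only [map_sum, map_smul]
  rw [this, map_eq_zero_iff f hf]

/-- A relation whose coefficient of `w` is `u * π ^ k` with `k` too small can be multiplied up until
it puts `π ^ (lam - 1) • w` in the old span. So the single test at exponent `lam - 1` detects every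
bad relation. -/
theorem typeIndependent_snoc_iff [Finite R] (hR : IsChainRing R) (hπ : (Ideal.span {π}).IsMaximal)
    {lam : Fin (K + 1) → ℕ} (hlam : 0 < lam (Fin.last K))
    (hlam' : lam (Fin.last K) ≤ nilpotencyClass π) {v : Fin K → M} {w : M} :
    TypeIndependent π lam (Fin.snoc v w : Fin (K + 1) → M) ↔
      TypeIndependent π (fun i => lam i.castSucc) v ∧ π ^ lam (Fin.last K) • w = 0 ∧
        π ^ (lam (Fin.last K) - 1) • w ∉ Submodule.span R (Set.range v) := by
  have hsum : ∀ r : Fin (K + 1) → R, ∑ i, r i • (Fin.snoc v w : Fin (K + 1) → M) i =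
      ∑ i : Fin K, r i.castSucc • v i + r (Fin.last K) • w := by
    intro r
    rw [Fin.sum_univ_castSucc]
    simp only [Fin.snoc_castSucc, Fin.snoc_last]
  have hlastmem : ∀ j, π ^ j ∈ Ideal.span {π ^ lam (Fin.last K)} ↔ lam (Fin.last K) ≤ j := by
    intro j
    have := IsChainRing.unit_mul_pow_mem_iff hR hπ isUnit_one (i := j) hlam'
    rwa [one_mul] at this
  constructor
  · intro h
    refine ⟨fun r => ?_, ?_, ?_⟩
    · have h1 := h (Fin.snoc r 0)
      rw [hsum] at h1
      simp only [Fin.snoc_castSucc, Fin.snoc_last, zero_smul, add_zero, Fin.forall_fin_succ',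
        zero_mem, and_true] at h1
      exact h1
    · have h1 := (h (Fin.snoc 0 (π ^ lam (Fin.last K)))).2 (by
        simp [Fin.forall_fin_succ'])
      rw [hsum] at h1
      simpa using h1
    · intro hmem
      rw [← Fintype.range_linearCombination] at hmem
      obtain ⟨r, hr⟩ := hmem
      rw [Fintype.linearCombination_apply] at hr
      have h1 := (h (Fin.snoc r (-π ^ (lam (Fin.last K) - 1)))).1 (by
        rw [hsum]
        simp [hr]) (Fin.last K)
      rw [Fin.snoc_last, neg_mem_iff, hlastmem] at h1
      omega
  · rintro ⟨h1, h2, h3⟩ r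
    rw [hsum, Fin.forall_fin_succ', ← h1 (fun i => r i.castSucc)]
    have hann : ∀ a ∈ Ideal.span {π ^ lam (Fin.last K)}, a • w = 0 := by
      intro a ha
      obtain ⟨b, rfl⟩ := Ideal.mem_span_singleton'.1 ha
      rw [mul_smul, h2, smul_zero]
    constructor
    · intro h
      have hr : r (Fin.last K) ∈ Ideal.span {π ^ lam (Fin.last K)} := by
        by_contra hr
        have hr0 : r (Fin.last K) ≠ 0 := fun h0 => hr (h0 ▸ zero_mem _)
        obtain ⟨u, k, hu, hk⟩ := IsChainRing.exists_eq_unit_mul_pow hR hπ hr0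
        rw [hk, IsChainRing.unit_mul_pow_mem_iff hR hπ hu hlam'] at hr
        obtain ⟨u, rfl⟩ := hu
        refine h3 ?_
        have hm : r (Fin.last K) • w ∈ Submodule.span R (Set.range v) := by
          rw [eq_neg_of_add_eq_zero_right h]
          exact neg_mem (Submodule.sum_mem _ fun i _ =>
            Submodule.smul_mem _ _ (Submodule.subset_span ⟨i, rfl⟩))
        have h4 := Submodule.smul_mem _ (π ^ (lam (Fin.last K) - 1 - k) * ↑u⁻¹) hm
        rw [smul_smul, hk, mul_assoc, Units.inv_mul_cancel_left, ← pow_add,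
          Nat.sub_add_cancel (by omega)] at h4
        exact h4
      rw [hann _ hr, add_zero] at h
      exact ⟨h, hr⟩
    · rintro ⟨h, hr⟩
      rw [h, hann _ hr, add_zero]

end TypeIndependent

/-! ### Counting submodules of given type. -/

section Counting

theorem Nat.card_sigma_eq_mul {α : Type*} [Finite α] {β : α → Type*} [∀ a, Finite (β a)] {c : ℕ}
    (h : ∀ a, Nat.card (β a) = c) : Nat.card (Σ a, β a) = Nat.card α * c := by
  have := Fintype.ofFinite α
  rw [Nat.card_sigma, Finset.sum_congr rfl fun a _ => h a, Finset.sum_const, smul_eq_mul,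
    Finset.card_univ, Nat.card_eq_fintype_card]

variable {R : Type*} [Ring R] [Finite R] {π : R} {M : Type*} [AddCommGroup M] [Module R M] {K : ℕ}

theorem two_le_card_quotient (hπ : (Ideal.span {π}).IsMaximal) :
    2 ≤ Nat.card (R ⧸ Ideal.span {π}) := by
  have := Finite.of_surjective _ (Ideal.span {π}).mkQ_surjective
  have := Submodule.Quotient.nontrivial_iff.2 hπ.ne_top
  exact Finite.one_lt_card

theorem card_annihilatedBy_of_equiv (hR : IsChainRing R) (hπ : (Ideal.span {π}).IsMaximal)
    {lam : Fin K → ℕ} (hlam : ∀ i, lam i ≤ nilpotencyClass π)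
    (e : M ≃ₗ[R] ((i : Fin K) → R ⧸ Ideal.span {π ^ lam i})) (k : ℕ) :
    Nat.card (annihilatedBy (π ^ k) M) =
      Nat.card (R ⧸ Ideal.span {π}) ^ ∑ i, min (lam i) k := by
  rw [card_annihilatedBy_congr _ e, card_annihilatedBy_pi, ← Finset.prod_pow_eq_pow_sum]
  exact Finset.prod_congr rfl fun i _ =>
    IsChainRing.card_annihilatedBy_quotient hR hπ (hlam i) k

/-- The number of ways to extend a type independent tuple by one more element. -/
theorem card_extension (hR : IsChainRing R) (hπ : (Ideal.span {π}).IsMaximal) [Finite M]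
    {lam : Fin K → ℕ} {l : ℕ} (hl : 0 < l) (hlam : ∀ i, l ≤ lam i)
    (hlam' : ∀ i, lam i ≤ nilpotencyClass π) {v : Fin K → M} (hv : TypeIndependent π lam v) :
    Nat.card {w : M // π ^ l • w = 0 ∧ π ^ (l - 1) • w ∉ Submodule.span R (Set.range v)} =
      Nat.card (annihilatedBy (π ^ l) M) -
        Nat.card (R ⧸ Ideal.span {π}) ^ K * Nat.card (annihilatedBy (π ^ (l - 1)) M) := by
  set q := Nat.card (R ⧸ Ideal.span {π})
  have := Finite.of_surjective _ (Ideal.span {π}).mkQ_surjective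
  have hq : 0 < q := Nat.card_pos
  set T := Submodule.span R (Set.range v)
  obtain ⟨e⟩ := hv.nonempty_span_equiv
  let f : M →+ M := DistribSMul.toAddMonoidHom M (π ^ (l - 1))
  have hfker : f.ker = annihilatedBy (π ^ (l - 1)) M := rfl
  have hpow : ∀ x : M, π • f x = π ^ l • x := by
    intro x
    change π • π ^ (l - 1) • x = _
    rw [smul_smul, ← pow_succ', Nat.sub_add_cancel hl]
  have hle : annihilatedBy (π ^ (l - 1)) M ≤ annihilatedBy (π ^ l) M := by
    intro x hx
    rw [mem_annihilatedBy] at hx ⊢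
    rw [← hpow]
    change π • π ^ (l - 1) • x = 0
    rw [hx, smul_zero]
  let A (k : ℕ) : AddSubgroup M := T.toAddSubgroup ⊓ annihilatedBy (π ^ k) M
  have hA : ∀ k, Nat.card (A k) = q ^ ∑ i, min (lam i) k := by
    intro k
    rw [← card_annihilatedBy_of_equiv hR hπ hlam' e k]
    refine Nat.card_congr ((Equiv.subtypeSubtypeEquivSubtypeInter (fun x => x ∈ T)
      (fun x => x ∈ annihilatedBy (π ^ k) M)).symm.trans (Equiv.subtypeEquivRight fun x => ?_))
    rw [mem_annihilatedBy, mem_annihilatedBy, ← Submodule.coe_smul, Submodule.coe_eq_zero]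
  -- As every part of `T` is at least `l`, each element of `T` killed by `π` is `π ^ (l - 1)` times
  -- an element of `T`. One inclusion plus equality of orders proves this.
  have hmap : (A l).map f = A 1 := by
    have hsub : (A l).map f ≤ A 1 := by
      rintro _ ⟨x, ⟨hxT, hx⟩, rfl⟩
      refine ⟨T.smul_mem _ hxT, ?_⟩
      refine mem_annihilatedBy.2 ?_
      rw [pow_one, hpow]
      exact mem_annihilatedBy.1 hx
    refine AddSubgroup.eq_of_le_of_card_ge hsub ?_
    have h1 := AddSubgroup.card_map_mul_card_inf_ker f (A l)
    have h2 : A l ⊓ f.ker = A (l - 1) := by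
      ext x
      exact ⟨fun h => ⟨h.1.1, h.2⟩, fun h => ⟨⟨h.1, hle h.2⟩, h.2⟩⟩
    rw [h2, hA, hA] at h1
    rw [hA]
    refine (Nat.eq_of_mul_eq_mul_right (pow_pos hq _) (h1.trans ?_)).ge
    rw [← pow_add, ← Finset.sum_add_distrib]
    congr 1
    refine Finset.sum_congr rfl fun i _ => ?_
    have := hlam i
    omega
  -- The forbidden choices of `w`: `f` maps them onto `A 1`, of order `q ^ K`, and its whole kernel
  -- lies among them.
  let B : AddSubgroup M := annihilatedBy (π ^ l) M ⊓ T.toAddSubgroup.comap f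
  have hB : Nat.card B = q ^ K * Nat.card (annihilatedBy (π ^ (l - 1)) M) := by
    rw [← AddSubgroup.card_map_mul_card_inf_ker f B]
    congr 1
    · have h3 : B.map f = A 1 := by
        refine le_antisymm ?_ ?_
        · rintro _ ⟨x, ⟨hx, hxT⟩, rfl⟩
          refine ⟨hxT, ?_⟩
          refine mem_annihilatedBy.2 ?_
          rw [pow_one, hpow]
          exact mem_annihilatedBy.1 hx
        · rw [← hmap]
          exact AddSubgroup.map_mono fun x hx => ⟨hx.2, T.smul_mem _ hx.1⟩
      rw [h3, hA]
      congr 1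
      rw [Finset.sum_congr rfl fun i _ => show min (lam i) 1 = 1 by have := hlam i; omega]
      simp
    · congr 2
      rw [hfker]
      ext x
      refine ⟨fun h => h.2, fun h => ⟨⟨hle h, ?_⟩, h⟩⟩
      change π ^ (l - 1) • x ∈ T
      rw [mem_annihilatedBy.1 h]
      exact T.zero_mem
  rw [← hB]
  have hBle : (B : Set M) ⊆ annihilatedBy (π ^ l) M := fun x hx => hx.1
  have h5 := Set.ncard_sdiff hBle
  have h6 : {w : M | π ^ l • w = 0 ∧ π ^ (l - 1) • w ∉ T} =
      (annihilatedBy (π ^ l) M : Set M) \ B := by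
    ext w
    simp only [Set.mem_ofPred_eq, Set.mem_sdiff, SetLike.mem_coe, mem_annihilatedBy]
    refine and_congr_right fun h => not_congr ⟨fun h' => ⟨mem_annihilatedBy.2 h, h'⟩, fun h' => h'.2⟩
  rw [← h6] at h5
  exact h5

theorem card_typeIndependent (hR : IsChainRing R) (hπ : (Ideal.span {π}).IsMaximal) [Finite M]
    {lam : Fin K → ℕ} (hanti : Antitone lam)
    (hlam : ∀ i, 0 < lam i ∧ lam i ≤ nilpotencyClass π) :
    Nat.card {v : Fin K → M // TypeIndependent π lam v} =
      ∏ i : Fin K, (Nat.card (annihilatedBy (π ^ lam i) M) -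
        Nat.card (R ⧸ Ideal.span {π}) ^ (i : ℕ) *
          Nat.card (annihilatedBy (π ^ (lam i - 1)) M)) := by
  induction K with
  | zero =>
    have h : ∀ v : Fin 0 → M, TypeIndependent π lam v := fun v r => by simp
    rw [Nat.card_congr (Equiv.subtypeUnivEquiv h)]
    simp
  | succ K ih =>
    have hl := hlam (Fin.last K)
    let E : {v : Fin (K + 1) → M // TypeIndependent π lam v} ≃
        Σ v : {v : Fin K → M // TypeIndependent π (fun i => lam i.castSucc) v},
          {w : M // π ^ lam (Fin.last K) • w = 0 ∧
            π ^ (lam (Fin.last K) - 1) • w ∉ Submodule.span R (Set.range v.1)} :=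
      { toFun := fun v =>
          have h := (typeIndependent_snoc_iff hR hπ hl.1 hl.2 (v := fun i => v.1 i.castSucc)
            (w := v.1 (Fin.last K))).1 (by
              have := v.2
              rwa [← Fin.snoc_init_self v.1] at this)
          ⟨⟨fun i => v.1 i.castSucc, h.1⟩, ⟨v.1 (Fin.last K), h.2⟩⟩
        invFun := fun p => ⟨Fin.snoc p.1.1 p.2.1,
          (typeIndependent_snoc_iff hR hπ hl.1 hl.2).2 ⟨p.1.2, p.2.2⟩⟩
        left_inv := fun v => Subtype.ext (Fin.snoc_init_self v.1)
        right_inv := fun p => Sigma.subtype_ext (Subtype.ext (funext fun i =>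
          Fin.snoc_castSucc (α := fun _ => M) _ _ i)) (Fin.snoc_last (α := fun _ => M) _ _) }
    rw [Nat.card_congr E, Nat.card_sigma_eq_mul fun v => card_extension hR hπ hl.1
      (fun i => hanti (Fin.le_last i.castSucc)) (fun i => (hlam i.castSucc).2) v.2,
      Fin.prod_univ_castSucc, ih (lam := fun i => lam i.castSucc) (fun i j h => hanti h) fun i => hlam _]
    simp

/-- Sort tuples by their span. A tuple inside a submodule `N` of the type spans a submodule
isomorphic to `N`, hence all of `N` by finiteness. -/
theorem card_typeIndependent_eq_ncard_mul {R : Type*} [Ring R] {π : R} {M : Type*}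
    [AddCommGroup M] [Module R M] [Finite M] {K : ℕ} (lam : Fin K → ℕ) {c : ℕ}
    (hc : ∀ N : Submodule R M, Nonempty (N ≃ₗ[R] ((i : Fin K) → R ⧸ Ideal.span {π ^ lam i})) →
      Nat.card {v : Fin K → N // TypeIndependent π lam v} = c) :
    Nat.card {v : Fin K → M // TypeIndependent π lam v} =
      {N : Submodule R M |
        Nonempty (N ≃ₗ[R] ((i : Fin K) → R ⧸ Ideal.span {π ^ lam i}))}.ncard * c := by
  let S := {N : Submodule R M |
    Nonempty (N ≃ₗ[R] ((i : Fin K) → R ⧸ Ideal.span {π ^ lam i}))}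
  let F : (Σ N : S, {v : Fin K → N.1 // TypeIndependent π lam v}) →
      {v : Fin K → M // TypeIndependent π lam v} := fun p =>
    ⟨fun i => p.1.1.subtype (p.2.1 i),
      (TypeIndependent.map_iff p.1.1.subtype_injective).2 p.2.2⟩
  have hspan : ∀ N : S, ∀ v : Fin K → N.1, TypeIndependent π lam v →
      Submodule.span R (Set.range fun i => (v i : M)) = N.1 := by
    rintro ⟨N, ⟨e⟩⟩ v hv
    have hv' : TypeIndependent π lam fun i => (v i : M) :=
      (TypeIndependent.map_iff N.subtype_injective).2 hv
    obtain ⟨e'⟩ := hv'.nonempty_span_equiv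
    have hle : Submodule.span R (Set.range fun i => (v i : M)) ≤ N := by
      rw [Submodule.span_le]
      rintro _ ⟨i, rfl⟩
      exact (v i).2
    refine SetLike.coe_injective (Set.eq_of_subset_of_ncard_le hle ?_)
    exact (Nat.card_congr (e.trans e'.symm).toEquiv).le
  have hF : Function.Bijective F := by
    constructor
    · rintro ⟨N, v, hv⟩ ⟨N', v', hv'⟩ h
      have h1 : (fun i => (v i : M)) = fun i => (v' i : M) := congrArg Subtype.val h
      have h2 : N = N' := by
        refine Subtype.ext ?_
        rw [← hspan N v hv, ← hspan N' v' hv', h1]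
      subst h2
      have h3 : v = v' := funext fun i => Subtype.ext (congrFun h1 i)
      subst h3
      rfl
    · rintro ⟨v, hv⟩
      refine ⟨⟨⟨Submodule.span R (Set.range v), hv.nonempty_span_equiv⟩,
        fun i => ⟨v i, Submodule.subset_span ⟨i, rfl⟩⟩, ?_⟩, rfl⟩
      exact (TypeIndependent.map_iff (Submodule.subtype_injective _)).1 hv
  rw [← Nat.card_congr (Equiv.ofBijective F hF), Nat.card_sigma_eq_mul fun N : S => hc N.1 N.2]
  rfl

theorem card_annihilatedBy_free (hR : IsChainRing R) (hπ : (Ideal.span {π}).IsMaximal) (n : ℕ)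
    {k : ℕ} (hk : k ≤ nilpotencyClass π) :
    Nat.card (annihilatedBy (π ^ k) (Fin n → R)) = Nat.card (R ⧸ Ideal.span {π}) ^ (n * k) := by
  have h0 : Ideal.span {π ^ nilpotencyClass π} = ⊥ := by
    rw [(IsChainRing.generator_pow_eq_zero_iff hR hπ).2 le_rfl, Ideal.span_singleton_zero]
  have e : (Fin n → R) ≃ₗ[R] (Fin n → R ⧸ Ideal.span {π ^ nilpotencyClass π}) :=
    LinearEquiv.piCongrRight fun _ => (Submodule.quotEquivOfEqBot _ h0).symm
  rw [card_annihilatedBy_of_equiv hR hπ (lam := fun _ => nilpotencyClass π) (fun _ => le_rfl) e k]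
  simp [hk]

/-- The submodules of `R ^ n` of type `lam`. -/
def typeSubmodules (π : R) (n : ℕ) (lam : Fin K → ℕ) : Set (Submodule R (Fin n → R)) :=
  {N | HasModuleType π N lam}

theorem ncard_typeSubmodules_mul (hR : IsChainRing R) (hπ : (Ideal.span {π}).IsMaximal) (n : ℕ)
    {lam : Fin K → ℕ} (hanti : Antitone lam)
    (hlam : ∀ i, 0 < lam i ∧ lam i ≤ nilpotencyClass π) :
    (typeSubmodules π n lam).ncard *
        ∏ i : Fin K, (Nat.card (R ⧸ Ideal.span {π}) ^ (∑ j, min (lam j) (lam i)) -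
          Nat.card (R ⧸ Ideal.span {π}) ^ (i : ℕ) *
            Nat.card (R ⧸ Ideal.span {π}) ^ (∑ j, min (lam j) (lam i - 1))) =
      ∏ i : Fin K, (Nat.card (R ⧸ Ideal.span {π}) ^ (n * lam i) -
          Nat.card (R ⧸ Ideal.span {π}) ^ (i : ℕ) *
            Nat.card (R ⧸ Ideal.span {π}) ^ (n * (lam i - 1))) := by
  have h1 := card_typeIndependent (M := Fin n → R) hR hπ hanti hlam
  have h2 := card_typeIndependent_eq_ncard_mul (M := Fin n → R) (π := π) lam
    (c := ∏ i : Fin K, (Nat.card (R ⧸ Ideal.span {π}) ^ (∑ j, min (lam j) (lam i)) -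
          Nat.card (R ⧸ Ideal.span {π}) ^ (i : ℕ) *
            Nat.card (R ⧸ Ideal.span {π}) ^ (∑ j, min (lam j) (lam i - 1)))) (by
      rintro N ⟨e⟩
      rw [card_typeIndependent hR hπ hanti hlam]
      refine Finset.prod_congr rfl fun i _ => ?_
      rw [card_annihilatedBy_of_equiv hR hπ (fun i => (hlam i).2) e,
        card_annihilatedBy_of_equiv hR hπ (fun i => (hlam i).2) e])
  have h3 : typeSubmodules π n lam = {N : Submodule R (Fin n → R) |
      Nonempty (N ≃ₗ[R] ((i : Fin K) → R ⧸ Ideal.span {π ^ lam i}))} := by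
    ext N
    exact ⟨fun h => h.2.2, fun h => ⟨hanti, hlam, h⟩⟩
  rw [h3, ← h2, h1]
  refine Finset.prod_congr rfl fun i _ => ?_
  rw [card_annihilatedBy_free hR hπ n (hlam i).2,
    card_annihilatedBy_free hR hπ n ((Nat.sub_le _ _).trans (hlam i).2)]

theorem sum_min_eq_of_hasModuleType (hR : IsChainRing R) (hπ : (Ideal.span {π}).IsMaximal)
    {lam mu : Fin K → ℕ} (h : HasModuleType π M lam) (h' : HasModuleType π M mu) (k : ℕ) :
    ∑ i, min (lam i) k = ∑ i, min (mu i) k := by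
  obtain ⟨-, hl, ⟨e⟩⟩ := h
  obtain ⟨-, hm, ⟨e'⟩⟩ := h'
  have h1 := card_annihilatedBy_of_equiv hR hπ (fun i => (hl i).2) e k
  rw [card_annihilatedBy_of_equiv hR hπ (fun i => (hm i).2) e' k] at h1
  exact (Nat.pow_right_injective (two_le_card_quotient hπ) h1).symm

theorem HasModuleType.eq_const_of_free (hR : IsChainRing R) (hπ : (Ideal.span {π}).IsMaximal)
    [Finite M] {lam : Fin K → ℕ} (h : HasModuleType π M lam) [Module.Free R M] :
    lam = fun _ => nilpotencyClass π := by
  have hpos := IsChainRing.nilpotencyClass_generator_pos hR hπ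
  have hnt : Nontrivial R := (Submodule.nontrivial_iff R).1 ⟨⟨_, _, hπ.ne_top⟩⟩
  obtain ⟨-, hl, ⟨e⟩⟩ := h
  have hfin : Module.Finite R M := Module.Finite.of_finite
  let b := Module.finBasis R M
  have h1 : ∀ k ≤ nilpotencyClass π, ∑ i, min (lam i) k = Module.finrank R M * k := by
    intro k hk
    have h2 := card_annihilatedBy_of_equiv hR hπ (fun i => (hl i).2) e k
    rw [card_annihilatedBy_congr _ b.equivFun, card_annihilatedBy_free hR hπ _ hk] at h2
    exact (Nat.pow_right_injective (two_le_card_quotient hπ) h2).symm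
  -- The elements killed by `π` fix the number of parts. Those killed by `π ^ s`, where `s` is the
  -- nilpotency class, then force every part to reach its upper bound.
  have h2 : K = Module.finrank R M := by
    have := h1 1 hpos
    rw [Finset.sum_congr rfl fun i _ => show min (lam i) 1 = 1 by have := hl i; omega] at this
    simpa using this
  have h3 : ∑ i, lam i = ∑ i : Fin K, nilpotencyClass π := by
    have := h1 _ le_rfl
    rw [Finset.sum_congr rfl fun i _ => min_eq_left (hl i).2] at this
    rw [this, ← h2]
    simp
  have h4 := (Finset.sum_eq_sum_iff_of_le fun i _ => (hl i).2).1 h3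
  exact funext fun i => h4 i (Finset.mem_univ _)

theorem freeRankSubmodules_eq_typeSubmodules (hR : IsChainRing R)
    (hπ : (Ideal.span {π}).IsMaximal) (n K : ℕ) :
    freeRankSubmodules π n K = typeSubmodules π n (fun _ : Fin K => nilpotencyClass π) := by
  ext N
  constructor
  · rintro ⟨⟨lam, hlam⟩, hfree⟩
    rw [hlam.eq_const_of_free hR hπ] at hlam
    exact hlam
  · intro h
    refine ⟨⟨_, h⟩, ?_⟩
    obtain ⟨-, -, ⟨e⟩⟩ := h
    have h0 : Ideal.span {π ^ nilpotencyClass π} = ⊥ := by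
      rw [(IsChainRing.generator_pow_eq_zero_iff hR hπ).2 le_rfl, Ideal.span_singleton_zero]
    have e' : (Fin K → R) ≃ₗ[R] (Fin K → R ⧸ Ideal.span {π ^ nilpotencyClass π}) :=
      LinearEquiv.piCongrRight fun _ => (Submodule.quotEquivOfEqBot _ h0).symm
    exact Module.Free.of_equiv (e'.trans e.symm)

end Counting

/-! ### Combinatorics of partitions with bounded parts. -/

/-- The multiplicity of the part `s - 1 - i` in `lam`, for each `i`. -/
def partMultiplicity {K : ℕ} (s : ℕ) (lam : Fin K → ℕ) : Fin (s - 1) → ℕ :=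
  fun i => (Finset.univ.filter fun j => lam j = s - 1 - i).card

section Combinatorics

variable {K s : ℕ} {lam : Fin K → ℕ}

theorem sum_Ici_partMultiplicity (hlam : ∀ j, 0 < lam j ∧ lam j ≤ s) (i : Fin (s - 1)) :
    ∑ l ∈ Finset.Ici i, partMultiplicity s lam l =
      (Finset.univ.filter fun j => lam j < s - i).card := by
  simp only [partMultiplicity, Finset.card_filter]
  rw [Finset.sum_comm]
  refine Finset.sum_congr rfl fun j _ => ?_
  rw [← Finset.card_filter]
  have hj := hlam j
  have hi := i.2
  split_ifs with h
  · rw [Finset.card_eq_one]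
    refine ⟨⟨s - 1 - lam j, by omega⟩, ?_⟩
    ext l
    have hl := l.2
    simp only [Finset.mem_filter, Finset.mem_Ici, Finset.mem_singleton, Fin.ext_iff, Fin.le_def]
    omega
  · rw [Finset.card_eq_zero, Finset.filter_eq_empty_iff]
    intro l hl
    have hl' := l.2
    rw [Finset.mem_Ici, Fin.le_def] at hl
    omega

theorem add_sum_ite_lt_sub_eq {l : ℕ} (hl : 0 < l ∧ l ≤ s) :
    l + ∑ i : Fin (s - 1), (if l < s - i then 1 else 0) = s := by
  rw [Fin.sum_univ_eq_sum_range (fun i => if l < s - i then 1 else 0), ← Finset.card_filter]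
  have : (Finset.range (s - 1)).filter (fun i => l < s - i) = Finset.range (s - l) := by
    ext i
    simp only [Finset.mem_filter, Finset.mem_range]
    omega
  rw [this, Finset.card_range]
  omega

/-- With `N_i` the number of parts below `s - i`, the parts sum to `sK - ∑ N_i` and the pairwise
minima to `sK² - 2K ∑ N_i + ∑ N_i²`. The `2K` in the ambient rank cancels the linear term, leaving
`∑ N_i² + d ∑ N_i`. -/
theorem exponent_identity (hlam : ∀ j, 0 < lam j ∧ lam j ≤ s) (d : ℕ) :
    (2 * K + d) * (s * K) + ∑ i, ∑ j, min (lam j) (lam i) =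
      (2 * K + d) * ∑ i, lam i + s * K ^ 2 +
        (∑ i, (∑ l ∈ Finset.Ici i, partMultiplicity s lam l) ^ 2 +
          d * ∑ i, ∑ l ∈ Finset.Ici i, partMultiplicity s lam l) := by
  simp only [sum_Ici_partMultiplicity hlam]
  let e : Fin (s - 1) → Fin K → ℤ := fun i j => if lam j < s - i then 1 else 0
  have hN : ∀ i : Fin (s - 1),
      ((Finset.univ.filter fun j => lam j < s - i).card : ℤ) = ∑ j, e i j := by
    intro i
    simp [e]
  have h1 : ∀ j, (lam j : ℤ) = s - ∑ i, e i j := by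
    intro j
    have h := congrArg (Nat.cast : ℕ → ℤ) (add_sum_ite_lt_sub_eq (hlam j))
    push_cast at h
    linarith
  have h2 : ∀ j k, ((min (lam j) (lam k) : ℕ) : ℤ) =
      s - ∑ i, e i j - ∑ i, e i k + ∑ i, e i j * e i k := by
    intro j k
    have h := congrArg (Nat.cast : ℕ → ℤ) (add_sum_ite_lt_sub_eq (s := s)
      (l := min (lam j) (lam k)) ⟨lt_min (hlam j).1 (hlam k).1, (min_le_left _ _).trans (hlam j).2⟩)
    -- Inclusion-exclusion: the minimum is below a bound exactly when one of the two parts is.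
    have h3 : ∀ i : Fin (s - 1), ((if min (lam j) (lam k) < s - i then 1 else 0 : ℕ) : ℤ) =
        e i j + e i k - e i j * e i k := by
      intro i
      simp only [e, min_lt_iff]
      by_cases ha : lam j < s - i <;> by_cases hb : lam k < s - i <;> simp [ha, hb]
    rw [Nat.cast_add, Nat.cast_sum, Finset.sum_congr rfl fun i _ => h3 i,
      Finset.sum_sub_distrib, Finset.sum_add_distrib] at h
    linarith
  have h4 : ∑ i, ∑ j, ∑ k, e k j * e k i = ∑ k, (∑ j, e k j) ^ 2 := by
    rw [Finset.sum_congr rfl fun i _ => Finset.sum_comm, Finset.sum_comm]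
    refine Finset.sum_congr rfl fun k _ => ?_
    rw [sq, Finset.mul_sum]
    exact Finset.sum_congr rfl fun i _ => (Finset.sum_mul _ _ _).symm
  have h5 : ∑ j, ∑ i, e i j = ∑ i, ∑ j, e i j := Finset.sum_comm
  have h6 : ∑ i, ∑ j, ((min (lam j) (lam i) : ℕ) : ℤ) =
      s * K ^ 2 - 2 * K * ∑ i, ∑ j, e i j + ∑ k, (∑ j, e k j) ^ 2 := by
    simp only [h2]
    simp only [Finset.sum_add_distrib, Finset.sum_sub_distrib, h4, Finset.sum_const,
      Finset.card_univ, Fintype.card_fin, nsmul_eq_mul, ← Finset.mul_sum, h5]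
    ring
  have h7 : ∑ i, (lam i : ℤ) = s * K - ∑ i, ∑ j, e i j := by
    simp only [h1, Finset.sum_sub_distrib, h5, Finset.sum_const, Finset.card_univ,
      Fintype.card_fin, nsmul_eq_mul]
    ring
  rw [← Nat.cast_inj (R := ℤ)]
  push_cast
  simp only [Nat.cast_min] at h6
  rw [h6, h7]
  simp only [hN]
  ring

/-- Along a block of `r` equal parts the exponent runs through `r, …, 1`. The induction removes the
first, largest part: its factor is the top one of its block, and the other exponents are unchanged
because count and index both drop by one. -/
theorem prod_one_sub_pow_eq_prod_qPochhammer (x : ℝ) (hanti : Antitone lam) (S : Finset ℕ)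
    (hS : ∀ j, lam j ∈ S) :
    ∏ j : Fin K, (1 - x ^ ((Finset.univ.filter fun a => lam j ≤ lam a).card - j)) =
      ∏ k ∈ S, qPochhammer x x (Finset.univ.filter fun j => lam j = k).card := by
  induction K with
  | zero => simp [qPochhammer]
  | succ K ih =>
    have hanti' : Antitone fun j : Fin K => lam j.succ := fun i j h =>
      hanti (Fin.succ_le_succ_iff.2 h)
    have hle : ∀ j, lam j ≤ lam 0 := fun j => hanti (Fin.zero_le j)
    rw [Fin.prod_univ_succ]
    have h1 : ∀ j : Fin K, (Finset.univ.filter fun a => lam j.succ ≤ lam a).card - (j.succ : ℕ) =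
        (Finset.univ.filter fun a : Fin K => lam j.succ ≤ lam a.succ).card - j := by
      intro j
      rw [Fin.card_filter_univ_succ, if_pos (hle _), Fin.val_succ]
      omega
    simp only [h1]
    rw [ih hanti' fun j => hS _]
    rw [← Finset.mul_prod_erase S _ (hS 0), ← Finset.mul_prod_erase S _ (hS 0), ← mul_assoc]
    congr 1
    · have h2 : (Finset.univ.filter fun a => lam 0 ≤ lam a).card - ((0 : Fin (K + 1)) : ℕ) =
          (Finset.univ.filter fun j : Fin K => lam j.succ = lam 0).card + 1 := by
        rw [Fin.card_filter_univ_succ, if_pos le_rfl]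
        simp only [Fin.val_zero, Nat.sub_zero]
        congr 2
        ext j
        simp only [Finset.mem_filter, Finset.mem_univ, true_and]
        exact ⟨fun h => le_antisymm (hle _) h, fun h => h.ge⟩
      have h3 : (Finset.univ.filter fun j => lam j = lam 0).card =
          (Finset.univ.filter fun j : Fin K => lam j.succ = lam 0).card + 1 := by
        rw [Fin.card_filter_univ_succ, if_pos rfl]
      rw [h2, h3, qPochhammer, qPochhammer, Finset.prod_range_succ, pow_succ', mul_comm]
    · refine Finset.prod_congr rfl fun k hk => ?_
      rw [Fin.card_filter_univ_succ, if_neg (Finset.ne_of_mem_erase hk).symm]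

theorem prod_Icc_eq_mul_prod_fin (hs : 0 < s) (g : ℕ → ℝ) :
    ∏ k ∈ Finset.Icc 1 s, g k = g s * ∏ i : Fin (s - 1), g (s - 1 - i) := by
  obtain ⟨t, rfl⟩ := Nat.exists_eq_succ_of_ne_zero hs.ne'
  rw [Nat.succ_eq_add_one, Nat.add_sub_cancel, Finset.prod_Icc_succ_top (by omega), mul_comm,
    Fin.prod_univ_eq_prod_range (fun i => g (t - i))]
  congr 1
  rw [← Finset.prod_range_reflect, ← Finset.Ico_add_one_right_eq_Icc,
    Finset.prod_Ico_eq_prod_range]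
  refine Finset.prod_congr (by simp) fun i hi => ?_
  rw [Finset.mem_range] at hi
  congr 1
  omega

theorem sum_partMultiplicity_add (hs : 0 < s) (hlam : ∀ j, 0 < lam j ∧ lam j ≤ s) :
    (Finset.univ.filter fun j => lam j = s).card + ∑ i, partMultiplicity s lam i = K := by
  have h : ∑ i, partMultiplicity s lam i = (Finset.univ.filter fun j => ¬ lam j = s).card := by
    simp only [partMultiplicity, Finset.card_filter]
    rw [Finset.sum_comm]
    refine Finset.sum_congr rfl fun j _ => ?_
    rw [← Finset.card_filter]
    have hj := hlam j
    split_ifs with h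
    · rw [Finset.card_eq_zero, Finset.filter_eq_empty_iff]
      intro l hl
      have hl' := l.2
      omega
    · rw [Finset.card_eq_one]
      refine ⟨⟨s - 1 - lam j, by omega⟩, ?_⟩
      ext l
      have hl := l.2
      simp only [Finset.mem_filter, Finset.mem_univ, true_and, Finset.mem_singleton, Fin.ext_iff]
      omega
  rw [h, Finset.card_filter_add_card_filter_not]
  simp

theorem prod_one_sub_pow_eq (x : ℝ) (hs : 0 < s) (hanti : Antitone lam)
    (hlam : ∀ j, 0 < lam j ∧ lam j ≤ s) :
    ∏ j : Fin K, (1 - x ^ ((Finset.univ.filter fun a => lam j ≤ lam a).card - j)) =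
      qPochhammer x x (K - ∑ i, partMultiplicity s lam i) *
        ∏ i, qPochhammer x x (partMultiplicity s lam i) := by
  rw [prod_one_sub_pow_eq_prod_qPochhammer x hanti (Finset.Icc 1 s)
    fun j => Finset.mem_Icc.2 (hlam j), prod_Icc_eq_mul_prod_fin hs]
  congr 2
  have := sum_partMultiplicity_add hs hlam
  omega

theorem Antitone.le_iff_lt_card (hanti : Antitone lam) (j : Fin K) (k : ℕ) :
    k ≤ lam j ↔ (j : ℕ) < (Finset.univ.filter fun a => k ≤ lam a).card := by
  constructor
  · intro h
    have hsub : Finset.Iic j ⊆ Finset.univ.filter fun a => k ≤ lam a := fun a ha =>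
      Finset.mem_filter.2 ⟨Finset.mem_univ _, h.trans (hanti (Finset.mem_Iic.1 ha))⟩
    have := Finset.card_le_card hsub
    rw [Fin.card_Iic] at this
    omega
  · intro h
    by_contra hk
    have hsub : (Finset.univ.filter fun a => k ≤ lam a) ⊆ Finset.Iio j := fun a ha => by
      rw [Finset.mem_Iio]
      by_contra hja
      exact hk ((Finset.mem_filter.1 ha).2.trans (hanti (not_lt.1 hja)))
    have := Finset.card_le_card hsub
    rw [Fin.card_Iio] at this
    omega

/-- Successive differences in `k` give the conjugate partition, which determines a nonincreasing
sequence. -/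
theorem eq_of_sum_min_eq {mu : Fin K → ℕ} (hanti : Antitone lam) (hanti' : Antitone mu)
    (h : ∀ k, ∑ j, min (lam j) k = ∑ j, min (mu j) k) : lam = mu := by
  have hcard : ∀ (nu : Fin K → ℕ) (k : ℕ), ∑ j, min (nu j) (k + 1) =
      ∑ j, min (nu j) k + (Finset.univ.filter fun a => k + 1 ≤ nu a).card := by
    intro nu k
    rw [Finset.card_filter, ← Finset.sum_add_distrib]
    refine Finset.sum_congr rfl fun j _ => ?_
    split_ifs <;> omega
  have key : ∀ k j, k + 1 ≤ lam j ↔ k + 1 ≤ mu j := by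
    intro k j
    rw [hanti.le_iff_lt_card, hanti'.le_iff_lt_card]
    have h1 := hcard lam k
    have h2 := hcard mu k
    have h3 := h k
    have h4 := h (k + 1)
    omega
  funext j
  have h1 := key (lam j) j
  have h2 := key (mu j) j
  have h3 := key (lam j - 1) j
  have h4 := key (mu j - 1) j
  omega

theorem eq_of_partMultiplicity_eq {mu : Fin K → ℕ} (hanti : Antitone lam) (hanti' : Antitone mu)
    (hlam : ∀ j, 0 < lam j ∧ lam j ≤ s) (hmu : ∀ j, 0 < mu j ∧ mu j ≤ s)
    (h : partMultiplicity s lam = partMultiplicity s mu) : lam = mu := by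
  have key : ∀ (i : Fin (s - 1)) (j : Fin K), lam j < s - i ↔ mu j < s - i := by
    intro i j
    have h1 := sum_Ici_partMultiplicity hlam i
    rw [h, sum_Ici_partMultiplicity hmu i] at h1
    have h2 := Finset.card_filter_add_card_filter_not (s := Finset.univ)
      (fun a => lam a < s - i)
    have h3 := Finset.card_filter_add_card_filter_not (s := Finset.univ)
      (fun a => mu a < s - i)
    simp only [not_lt] at h2 h3
    rw [← not_le, ← not_le, hanti.le_iff_lt_card, hanti'.le_iff_lt_card]
    omega
  funext j
  have h1 := add_sum_ite_lt_sub_eq (hlam j)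
  have h2 := add_sum_ite_lt_sub_eq (hmu j)
  simp only [key] at h1
  omega

theorem eq_of_sum_Ici_eq {t : ℕ} {m m' : Fin t → ℕ}
    (h : ∀ i, ∑ l ∈ Finset.Ici i, m l = ∑ l ∈ Finset.Ici i, m' l) : m = m' := by
  funext i
  induction i using WellFoundedGT.induction with
  | ind i ih =>
    have h1 := h i
    rw [← Finset.Ioi_insert, Finset.sum_insert (by simp), Finset.sum_insert (by simp),
      Finset.sum_congr rfl fun l hl => ih l (Finset.mem_Ioi.1 hl)] at h1
    exact Nat.add_right_cancel h1

theorem exists_partMultiplicity_eq (hs : 0 < s) {m : Fin (s - 1) → ℕ} (hm : ∑ i, m i ≤ K) :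
    ∃ lam : Fin K → ℕ, Antitone lam ∧ (∀ j, 0 < lam j ∧ lam j ≤ s) ∧
      partMultiplicity s lam = m := by
  let T : Fin (s - 1) → ℕ := fun i => ∑ l ∈ Finset.Ici i, m l
  have hT : Antitone T := fun i j h =>
    Finset.sum_le_sum_of_subset (Finset.Ici_subset_Ici.2 h)
  have hTK : ∀ i, T i ≤ K := fun i =>
    (Finset.sum_le_sum_of_subset (Finset.subset_univ _)).trans hm
  -- The parts below `s - i` must be exactly the last `T i`, so the part at `j` drops from `s` by
  -- one for each `i` with `j ≥ K - T i`.
  let c : Fin K → ℕ := fun j => (Finset.univ.filter fun i => K - j ≤ T i).card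
  have hc : ∀ j, c j ≤ s - 1 := fun j => (Finset.card_le_univ _).trans (by simp)
  have hlam : ∀ j, 0 < s - c j ∧ s - c j ≤ s := fun j => by have := hc j; omega
  refine ⟨fun j => s - c j, fun i j h => ?_, hlam, eq_of_sum_Ici_eq fun i => ?_⟩
  · refine Nat.sub_le_sub_left (Finset.card_le_card fun l hl => ?_) s
    rw [Finset.mem_filter] at hl ⊢
    have : (i : ℕ) ≤ j := h
    exact ⟨hl.1, by omega⟩
  · rw [sum_Ici_partMultiplicity hlam]
    have h1 : ∀ j : Fin K, s - c j < s - i ↔ K - T i ≤ j := by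
      intro j
      have h2 := hT.le_iff_lt_card i (K - j)
      have h3 : c j = (Finset.univ.filter fun i => K - j ≤ T i).card := rfl
      have := hc j
      have := i.2
      have := j.2
      have := hTK i
      omega
    simp only [h1]
    have h4 := Finset.card_filter_add_card_filter_not (s := (Finset.univ : Finset (Fin K)))
      (fun j => K - T i ≤ (j : ℕ))
    simp only [not_le] at h4
    rw [Fin.card_filter_val_lt, Finset.card_univ, Fintype.card_fin] at h4
    have := hTK i
    change _ = T i
    omega

end Combinatorics

/-! ### Comparison with the free type. -/

/-- The number of submodules of a type with multiplicities `m`, relative to the free ones, among the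
submodules of rank `K` of a free module of rank `2 * K + d`. -/
noncomputable def typeWeight (x : ℝ) (s K d : ℕ) (m : Fin (s - 1) → ℕ) : ℝ :=
  x ^ (∑ i, (∑ l ∈ Finset.Ici i, m l) ^ 2 + d * ∑ i, ∑ l ∈ Finset.Ici i, m l) *
    (qPochhammer x x K / (qPochhammer x x (K - ∑ i, m i) * ∏ i, qPochhammer x x (m i)))

theorem qPochhammer_self_pos {x : ℝ} (hx0 : 0 ≤ x) (hx1 : x < 1) (r : ℕ) :
    0 < qPochhammer x x r := by
  refine Finset.prod_pos fun i _ => ?_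
  rw [← pow_succ', sub_pos]
  exact pow_lt_one₀ hx0 hx1 (Nat.succ_ne_zero i)

theorem natCast_pow_sub_pow_mul_pow {q : ℕ} (hq : 2 ≤ q) {a b c : ℕ} (hb : c ≤ b) (ha : b ≤ a) :
    ((q ^ a - q ^ c * q ^ (a - b) : ℕ) : ℝ) = (q : ℝ) ^ a * (1 - (1 / (q : ℝ)) ^ (b - c)) := by
  have hq0 : (q : ℝ) ≠ 0 := by positivity
  have h1 : q ^ c * q ^ (a - b) * q ^ (b - c) = q ^ a := by
    rw [← pow_add, ← pow_add]
    congr 1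
    omega
  have hle : q ^ c * q ^ (a - b) ≤ q ^ a := by
    rw [← h1]
    exact Nat.le_mul_of_pos_right _ (by positivity)
  have h2 := congrArg (Nat.cast : ℕ → ℝ) h1
  push_cast at h2
  rw [Nat.cast_sub hle]
  push_cast
  rw [mul_sub, mul_one, ← h2, one_div, inv_pow, mul_inv_cancel_right₀ (pow_ne_zero _ hq0)]

section Ratio

variable {R : Type*} [Ring R] [Finite R] {π : R} {K : ℕ}

theorem ncard_typeSubmodules_mul_real (hR : IsChainRing R) (hπ : (Ideal.span {π}).IsMaximal)
    {q s n : ℕ} (hq : q = Nat.card (R ⧸ Ideal.span {π})) (hs : s = nilpotencyClass π) (hs0 : 0 < s)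
    (hn : K ≤ n) {lam : Fin K → ℕ} (hanti : Antitone lam) (hlam : ∀ i, 0 < lam i ∧ lam i ≤ s) :
    ((typeSubmodules π n lam).ncard : ℝ) * ((q : ℝ) ^ (∑ i, ∑ j, min (lam j) (lam i)) *
        (qPochhammer (1 / q) (1 / q) (K - ∑ i, partMultiplicity s lam i) *
          ∏ i, qPochhammer (1 / q) (1 / q) (partMultiplicity s lam i))) =
      (q : ℝ) ^ (n * ∑ i, lam i) * ∏ i : Fin K, (1 - (1 / (q : ℝ)) ^ (n - i)) := by
  have hq2 : 2 ≤ q := hq ▸ two_le_card_quotient hπ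
  have h := congrArg (Nat.cast : ℕ → ℝ) (ncard_typeSubmodules_mul hR hπ n hanti (hs ▸ hlam))
  rw [← hq, Nat.cast_mul, Nat.cast_prod, Nat.cast_prod] at h
  have h1 : ∀ i : Fin K, ((q ^ (∑ j, min (lam j) (lam i)) -
      q ^ (i : ℕ) * q ^ (∑ j, min (lam j) (lam i - 1)) : ℕ) : ℝ) =
        (q : ℝ) ^ (∑ j, min (lam j) (lam i)) *
          (1 - (1 / (q : ℝ)) ^ ((Finset.univ.filter fun a => lam i ≤ lam a).card - i)) := by
    intro i
    have h2 : ∑ j, min (lam j) (lam i) = ∑ j, min (lam j) (lam i - 1) +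
        (Finset.univ.filter fun a => lam i ≤ lam a).card := by
      rw [Finset.card_filter, ← Finset.sum_add_distrib]
      refine Finset.sum_congr rfl fun j _ => ?_
      have := hlam i
      split_ifs <;> omega
    rw [← natCast_pow_sub_pow_mul_pow hq2 ((hanti.le_iff_lt_card i _).1 le_rfl).le
      (by rw [h2]; exact Nat.le_add_left _ _)]
    rw [h2, Nat.add_sub_cancel]
  have h3 : ∀ i : Fin K, ((q ^ (n * lam i) - q ^ (i : ℕ) * q ^ (n * (lam i - 1)) : ℕ) : ℝ) =
      (q : ℝ) ^ (n * lam i) * (1 - (1 / (q : ℝ)) ^ (n - i)) := by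
    intro i
    rw [← natCast_pow_sub_pow_mul_pow hq2 (i.2.le.trans hn)
      (Nat.le_mul_of_pos_right n (hlam i).1), Nat.mul_sub_one]
  rw [Finset.prod_congr rfl fun i _ => h1 i, Finset.prod_congr rfl fun i _ => h3 i,
    Finset.prod_mul_distrib, Finset.prod_mul_distrib, Finset.prod_pow_eq_pow_sum,
    Finset.prod_pow_eq_pow_sum, prod_one_sub_pow_eq _ hs0 hanti hlam, ← Finset.mul_sum] at h
  exact h

theorem ncard_typeSubmodules_eq (hR : IsChainRing R) (hπ : (Ideal.span {π}).IsMaximal)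
    {q s d : ℕ} (hq : q = Nat.card (R ⧸ Ideal.span {π})) (hs : s = nilpotencyClass π) (hs0 : 0 < s)
    {lam : Fin K → ℕ} (hanti : Antitone lam) (hlam : ∀ i, 0 < lam i ∧ lam i ≤ s) :
    ((typeSubmodules π (2 * K + d) lam).ncard : ℝ) =
      (freeRankSubmodules π (2 * K + d) K).ncard *
        typeWeight (1 / q) s K d (partMultiplicity s lam) ∧
      0 < (freeRankSubmodules π (2 * K + d) K).ncard := by
  have hq2 : 2 ≤ q := hq ▸ two_le_card_quotient hπ
  have hq0 : (0 : ℝ) < q := by positivity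
  have hx1 : 1 / (q : ℝ) < 1 := by
    rw [div_lt_one hq0]
    exact_mod_cast hq2
  have hpos := fun r => qPochhammer_self_pos (one_div_nonneg.2 hq0.le) hx1 r
  have h1 := ncard_typeSubmodules_mul_real hR hπ hq hs hs0 (n := 2 * K + d) (by omega) hanti hlam
  have h2 := ncard_typeSubmodules_mul_real hR hπ hq hs hs0 (n := 2 * K + d) (by omega)
    (lam := fun _ : Fin K => s) (fun _ _ _ => le_rfl) (fun _ => ⟨hs0, le_rfl⟩)
  have hE := exponent_identity hlam d
  have h0 : partMultiplicity s (fun _ : Fin K => s) = 0 := by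
    funext i
    have := i.2
    simp only [partMultiplicity, Finset.card_filter, Pi.zero_apply]
    exact Finset.sum_eq_zero fun j _ => if_neg (by omega)
  have hq1 : qPochhammer (1 / q : ℝ) (1 / q) 0 = 1 := Finset.prod_range_zero _
  rw [freeRankSubmodules_eq_typeSubmodules hR hπ, ← hs]
  simp only [h0, Pi.zero_apply, Finset.sum_const_zero, Nat.sub_zero, hq1, Finset.prod_const_one,
    mul_one, min_self, Finset.sum_const, Finset.card_univ, Fintype.card_fin, smul_eq_mul] at h2
  set W := ∏ i : Fin K, (1 - (1 / (q : ℝ)) ^ (2 * K + d - i)) with hWdef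
  have hW : 0 < W := Finset.prod_pos fun i _ => by
    rw [sub_pos]
    refine pow_lt_one₀ (one_div_nonneg.2 hq0.le) hx1 ?_
    have := i.2
    omega
  set P := qPochhammer (1 / (q : ℝ)) (1 / q) (K - ∑ i, partMultiplicity s lam i) *
    ∏ i, qPochhammer (1 / (q : ℝ)) (1 / q) (partMultiplicity s lam i) with hP
  have hPpos : 0 < P := mul_pos (hpos _) (Finset.prod_pos fun i _ => hpos _)
  have hKpos := hpos K
  set a := ((typeSubmodules π (2 * K + d) lam).ncard : ℝ)
  set b := (typeSubmodules π (2 * K + d) fun _ : Fin K => s).ncard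
  set E := ∑ i, (∑ l ∈ Finset.Ici i, partMultiplicity s lam l) ^ 2 +
    d * ∑ i, ∑ l ∈ Finset.Ici i, partMultiplicity s lam l with hEdef
  set S := ∑ i, ∑ j, min (lam j) (lam i)
  set Q := qPochhammer (1 / (q : ℝ)) (1 / q) K
  constructor
  · rw [typeWeight, ← hP, ← hEdef, one_div_pow]
    have e1 : (q : ℝ) ^ ((2 * K + d) * (K * s)) * (q : ℝ) ^ S =
        (q : ℝ) ^ ((2 * K + d) * ∑ i, lam i) * (q : ℝ) ^ (K * (K * s)) * (q : ℝ) ^ E := by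
      rw [← pow_add, ← pow_add, ← pow_add]
      congr 1
      linarith
    -- A common positive factor that lets both counting formulas be substituted without division.
    have hc : 0 < (q : ℝ) ^ ((2 * K + d) * (K * s)) * (q : ℝ) ^ S * W := by positivity
    rw [← mul_div_assoc, ← mul_div_assoc, eq_div_iff hPpos.ne', one_div_mul_eq_div, mul_div_assoc',
      eq_div_iff (by positivity)]
    refine mul_left_cancel₀ hc.ne' ?_
    calc _ = (a * ((q : ℝ) ^ S * P)) * ((q : ℝ) ^ ((2 * K + d) * (K * s)) * W) * (q : ℝ) ^ E := by
          ring
      _ = ((q : ℝ) ^ ((2 * K + d) * ∑ i, lam i) * (q : ℝ) ^ (K * (K * s)) * (q : ℝ) ^ E) * W *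
          (b * Q) := by
        rw [h1, ← h2]
        ring
      _ = _ := by
        rw [← e1]
  · have h3 : (0 : ℝ) < b * ((q : ℝ) ^ (K * (K * s)) * Q) := by
      rw [h2]
      positivity
    have h4 : (0 : ℝ) < b := pos_of_mul_pos_left h3 (by positivity)
    exact_mod_cast h4

/-- Rank `K` submodules are partitioned by type, and the multiplicity vector identifies types with
vectors of sum at most `K`; the parts equal to `s` fill the remainder. -/
theorem ncard_rankSubmodules_eq (hR : IsChainRing R) (hπ : (Ideal.span {π}).IsMaximal)
    {q s : ℕ} (K d : ℕ) (hq : q = Nat.card (R ⧸ Ideal.span {π})) (hs : s = nilpotencyClass π)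
    (hs0 : 0 < s) :
    ((rankSubmodules π (2 * K + d) K).ncard : ℝ) =
      (freeRankSubmodules π (2 * K + d) K).ncard *
        ∑' m : Fin (s - 1) → ℕ, if ∑ i, m i ≤ K then typeWeight (1 / q) s K d m else 0 := by
  classical
  let Λ : Finset (Fin K → ℕ) :=
    (Fintype.piFinset fun _ => Finset.Icc 1 s).filter fun lam => Antitone lam
  have hΛ : ∀ lam, lam ∈ Λ ↔ Antitone lam ∧ ∀ i, 0 < lam i ∧ lam i ≤ s := by
    intro lam
    simp only [Λ, Finset.mem_filter, Fintype.mem_piFinset, Finset.mem_Icc, Nat.succ_le_iff]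
    exact and_comm
  have h1 : rankSubmodules π (2 * K + d) K =
      ⋃ lam ∈ (Λ : Set (Fin K → ℕ)), typeSubmodules π (2 * K + d) lam := by
    ext N
    simp only [Set.mem_iUnion, exists_prop, Finset.mem_coe, hΛ]
    constructor
    · rintro ⟨lam, h⟩
      exact ⟨lam, ⟨h.1, hs ▸ h.2.1⟩, h⟩
    · rintro ⟨lam, -, h⟩
      exact ⟨lam, h⟩
  have hinj : Set.InjOn (partMultiplicity s) (Λ : Set (Fin K → ℕ)) := by
    intro lam hl mu hm h
    rw [Finset.mem_coe, hΛ] at hl hm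
    exact eq_of_partMultiplicity_eq hl.1 hm.1 hl.2 hm.2 h
  have hdisj : (Λ : Set (Fin K → ℕ)).PairwiseDisjoint (typeSubmodules π (2 * K + d)) := by
    intro lam hl mu hm hne
    rw [Function.onFun, Set.disjoint_left]
    intro N hN hN'
    refine hne ?_
    have hl' := (hΛ lam).1 hl
    have hm' := (hΛ mu).1 hm
    exact eq_of_sum_min_eq hl'.1 hm'.1 fun k => sum_min_eq_of_hasModuleType hR hπ hN hN' k
  have h2 : (rankSubmodules π (2 * K + d) K).ncard =
      ∑ lam ∈ Λ, (typeSubmodules π (2 * K + d) lam).ncard := by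
    rw [h1, Λ.finite_toSet.ncard_biUnion (fun _ _ => Set.toFinite _) hdisj,
      finsum_mem_coe_finset]
  rw [h2, Nat.cast_sum, Finset.sum_congr rfl fun lam hl => (ncard_typeSubmodules_eq hR hπ hq hs hs0
    ((hΛ lam).1 hl).1 ((hΛ lam).1 hl).2).1, ← Finset.mul_sum]
  congr 1
  rw [← Finset.sum_image (f := typeWeight (1 / q) s K d) hinj]
  have hmem : ∀ m, m ∈ Λ.image (partMultiplicity s) ↔ ∑ i, m i ≤ K := by
    intro m
    rw [Finset.mem_image]
    constructor
    · rintro ⟨lam, hl, rfl⟩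
      have := sum_partMultiplicity_add hs0 ((hΛ lam).1 hl).2
      omega
    · intro h
      obtain ⟨lam, h1, h2, h3⟩ := exists_partMultiplicity_eq hs0 h
      exact ⟨lam, (hΛ lam).2 ⟨h1, h2⟩, h3⟩
  rw [tsum_eq_sum (s := Λ.image (partMultiplicity s)) fun m hm => if_neg (mt (hmem m).2 hm)]
  exact Finset.sum_congr rfl fun m hm => (if_pos ((hmem m).1 hm)).symm

end Ratio

/-! ### Summability and passage to the limit. -/

section Limit

variable {x : ℝ}

theorem qPochhammer_self_antitone (hx0 : 0 ≤ x) (hx1 : x < 1) : Antitone (qPochhammer x x) := by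
  refine antitone_nat_of_succ_le fun r => ?_
  rw [qPochhammer, Finset.prod_range_succ]
  refine mul_le_of_le_one_right (qPochhammer_self_pos hx0 hx1 r).le ?_
  rw [← pow_succ', sub_le_self_iff]
  positivity

theorem one_fourth_le_qPochhammer_self (hx0 : 0 ≤ x) (hx : x ≤ 1 / 2) (r : ℕ) :
    1 / 4 ≤ qPochhammer x x r := by
  -- The bound 1/4 alone does not survive the induction; the extra power does. Starting at one
  -- factor gives `x ^ (r + 2) ≤ 1/4`, as the step needs, and the base case is sharp at `x = 1/2`.
  have key : ∀ r, 1 / 4 + x ^ (r + 2) ≤ qPochhammer x x (r + 1) := by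
    intro r
    induction r with
    | zero =>
      simp only [qPochhammer, zero_add, Finset.prod_range_one, pow_zero, mul_one]
      nlinarith
    | succ r ih =>
      rw [qPochhammer, Finset.prod_range_succ, ← qPochhammer]
      set y := x ^ (r + 2) with hy
      have hy0 : 0 ≤ y := by positivity
      have hy1 : y ≤ 1 / 4 := by
        calc y ≤ x ^ 2 := pow_le_pow_of_le_one hx0 (by linarith) (by omega)
          _ ≤ 1 / 4 := by nlinarith
      have h1 : x ^ (r + 1 + 2) = x * y := by rw [hy]; ring
      have h2 : x * x ^ (r + 1) = y := by rw [hy]; ring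
      rw [h1, h2]
      nlinarith [mul_le_mul_of_nonneg_right ih (show 0 ≤ 1 - y by linarith),
        mul_nonneg hy0 (show 0 ≤ 1 / 2 - x by linarith),
        mul_nonneg hy0 (show 0 ≤ 1 / 4 - y by linarith)]
  rcases r with _ | r
  · simp only [qPochhammer, Finset.prod_range_zero]
    norm_num
  · exact le_trans (le_add_of_nonneg_right (by positivity)) (key r)

theorem tendsto_qPochhammer_div (hx0 : 0 ≤ x) (hx : x ≤ 1 / 2) {K : ℕ → ℕ}
    (hK : Tendsto K atTop atTop) (a : ℕ) :
    Tendsto (fun j => qPochhammer x x (K j) / qPochhammer x x (K j - a)) atTop (𝓝 1) := by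
  have hbdd : BddBelow (Set.range (qPochhammer x x)) := by
    refine ⟨1 / 4, ?_⟩
    rintro _ ⟨r, rfl⟩
    exact one_fourth_le_qPochhammer_self hx0 hx r
  have h := tendsto_atTop_ciInf (qPochhammer_self_antitone hx0 (by linarith)) hbdd
  have hL : 1 / 4 ≤ ⨅ r, qPochhammer x x r := le_ciInf fun r =>
    one_fourth_le_qPochhammer_self hx0 hx r
  have h2 := (h.comp hK).div (h.comp ((tendsto_sub_atTop_nat a).comp hK)) (by linarith)
  rwa [div_self (by linarith)] at h2

theorem summable_prod_pow (hx0 : 0 ≤ x) (hx1 : x < 1) (t : ℕ) :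
    Summable fun m : Fin t → ℕ => ∏ i, x ^ m i := by
  induction t with
  | zero => exact (hasSum_fintype _).summable
  | succ t ih =>
    rw [← (Fin.consEquiv fun _ : Fin (t + 1) => ℕ).summable_iff]
    refine ((summable_geometric_of_lt_one hx0 hx1).mul_of_nonneg ih (fun _ => by positivity)
      fun _ => Finset.prod_nonneg fun _ _ => by positivity).congr fun p => ?_
    simp [Fin.prod_univ_succ, Fin.consEquiv]

theorem agiTerm_nonneg (hx0 : 0 ≤ x) (hx1 : x < 1) (s : ℕ) (m : Fin (s - 1) → ℕ) :
    0 ≤ agiTerm x s m :=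
  div_nonneg (by positivity) (Finset.prod_nonneg fun i _ => (qPochhammer_self_pos hx0 hx1 _).le)

theorem summable_agiTerm (hx0 : 0 ≤ x) (hx : x ≤ 1 / 2) (s : ℕ) : Summable (agiTerm x s) := by
  refine Summable.of_nonneg_of_le (agiTerm_nonneg hx0 (by linarith) s) (fun m => ?_)
    ((summable_prod_pow hx0 (by linarith) (s - 1)).mul_left (4 ^ (s - 1)))
  have h1 : (1 / 4 : ℝ) ^ (s - 1) ≤ ∏ i, qPochhammer x x (m i) := by
    calc (1 / 4 : ℝ) ^ (s - 1) = ∏ i : Fin (s - 1), (1 / 4 : ℝ) := by simp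
      _ ≤ _ := Finset.prod_le_prod (fun _ _ => by norm_num) fun i _ =>
        one_fourth_le_qPochhammer_self hx0 hx _
  -- Uses `N_i ^ 2 ≥ N_i ≥ n_i`, reducing to a product of geometric series.
  have h2 : x ^ (∑ i, (∑ j ∈ Finset.Ici i, m j) ^ 2) ≤ ∏ i, x ^ m i := by
    rw [Finset.prod_pow_eq_pow_sum]
    refine pow_le_pow_of_le_one hx0 (by linarith) (Finset.sum_le_sum fun i _ => ?_)
    exact (Finset.single_le_sum (f := m) (fun _ _ => Nat.zero_le _)
      (Finset.mem_Ici.2 le_rfl)).trans (Nat.le_self_pow two_ne_zero _)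
  have h3 : (4 : ℝ) ^ (s - 1) = 1 / (1 / 4) ^ (s - 1) := by
    rw [one_div_pow, one_div_one_div]
  rw [agiTerm, h3, one_div_mul_eq_div]
  exact div_le_div₀ (Finset.prod_nonneg fun i _ => by positivity) h2 (by positivity) h1

theorem agiTerm_zero (x : ℝ) (s : ℕ) : agiTerm x s 0 = 1 := by
  simp [agiTerm, qPochhammer]

theorem one_le_AGI (hx0 : 0 ≤ x) (hx : x ≤ 1 / 2) (s : ℕ) : 1 ≤ AGI x s := by
  rw [← agiTerm_zero x s]
  exact (summable_agiTerm hx0 hx s).le_tsum 0 fun m _ => agiTerm_nonneg hx0 (by linarith) s m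

theorem typeWeight_eq (x : ℝ) (s K d : ℕ) (m : Fin (s - 1) → ℕ) :
    typeWeight x s K d m = agiTerm x s m * x ^ (d * ∑ i, ∑ l ∈ Finset.Ici i, m l) *
      (qPochhammer x x K / qPochhammer x x (K - ∑ i, m i)) := by
  rw [typeWeight, agiTerm, pow_add, div_mul_eq_div_div]
  simp only [div_eq_mul_inv]
  ring

/-- Dominated convergence with the Andrews-Gordon terms as majorant. The function `c` isolates the
only dependence on `d`, so that one statement serves both regimes. -/
theorem tendsto_tsum_typeWeight (hx0 : 0 ≤ x) (hx : x ≤ 1 / 2) (s : ℕ) {K d : ℕ → ℕ}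
    (hK : Tendsto K atTop atTop) {c : (Fin (s - 1) → ℕ) → ℝ}
    (hc : ∀ m, Tendsto (fun j => x ^ (d j * ∑ i, ∑ l ∈ Finset.Ici i, m l)) atTop (𝓝 (c m))) :
    Tendsto (fun j => ∑' m : Fin (s - 1) → ℕ,
      if ∑ i, m i ≤ K j then typeWeight x s (K j) (d j) m else 0) atTop
      (𝓝 (∑' m, agiTerm x s m * c m)) := by
  have hx1 : x < 1 := by linarith
  refine tendsto_tsum_of_dominated_convergence (summable_agiTerm hx0 hx s) (fun m => ?_)
    (Eventually.of_forall fun j m => ?_)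
  · have h1 := (((hc m).const_mul (agiTerm x s m)).mul
      (tendsto_qPochhammer_div hx0 hx hK (∑ i, m i)))
    rw [mul_one] at h1
    refine h1.congr' ?_
    filter_upwards [hK.eventually_ge_atTop (∑ i, m i)] with j hj
    rw [if_pos hj, typeWeight_eq]
  · have h0 := agiTerm_nonneg hx0 hx1 s m
    split_ifs
    · have hp := qPochhammer_self_pos hx0 hx1
      rw [typeWeight_eq, Real.norm_of_nonneg (mul_nonneg (mul_nonneg h0 (by positivity))
        (div_nonneg (hp _).le (hp _).le)), mul_assoc]
      refine mul_le_of_le_one_right h0 (mul_le_one₀ (pow_le_one₀ hx0 hx1.le)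
        (div_nonneg (hp _).le (hp _).le) ?_)
      rw [div_le_one (hp _)]
      exact qPochhammer_self_antitone hx0 hx1 (Nat.sub_le _ _)
    · rwa [norm_zero]

theorem tendsto_tsum_typeWeight_AGI (hx0 : 0 ≤ x) (hx : x ≤ 1 / 2) (s : ℕ) {K d : ℕ → ℕ}
    (hK : Tendsto K atTop atTop) (hd : ∀ j, d j = 0) :
    Tendsto (fun j => ∑' m : Fin (s - 1) → ℕ,
      if ∑ i, m i ≤ K j then typeWeight x s (K j) (d j) m else 0) atTop (𝓝 (AGI x s)) := by
  have h := tendsto_tsum_typeWeight (d := d) hx0 hx s hK (c := fun _ => 1) (fun m => by simp [hd])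
  simp only [mul_one] at h
  exact h

theorem tendsto_tsum_typeWeight_one (hx0 : 0 ≤ x) (hx : x ≤ 1 / 2) (s : ℕ) {K d : ℕ → ℕ}
    (hK : Tendsto K atTop atTop) (hd : Tendsto d atTop atTop) :
    Tendsto (fun j => ∑' m : Fin (s - 1) → ℕ,
      if ∑ i, m i ≤ K j then typeWeight x s (K j) (d j) m else 0) atTop (𝓝 1) := by
  have h := tendsto_tsum_typeWeight (d := d) hx0 hx s hK (c := fun m => if m = 0 then 1 else 0)
    (fun m => by
      split_ifs with hm
      · simp [hm]
      · obtain ⟨i, hi⟩ := Function.ne_iff.1 hm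
        have hpos : 0 < ∑ i, ∑ l ∈ Finset.Ici i, m l :=
          Finset.sum_pos' (fun _ _ => Nat.zero_le _) ⟨i, Finset.mem_univ _,
            Finset.sum_pos' (fun _ _ => Nat.zero_le _)
              ⟨i, Finset.mem_Ici.2 le_rfl, Nat.pos_of_ne_zero hi⟩⟩
        exact (tendsto_pow_atTop_nhds_zero_of_lt_one hx0 (by linarith)).comp
          (hd.atTop_mul_const' hpos))
  simpa [agiTerm_zero] using h

end Limit

/-! ### The density of free submodules. -/

theorem freeProportion_eq_inv_tsum {R : Type*} [Ring R] [Finite R] {π : R} (hR : IsChainRing R)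
    (hπ : (Ideal.span {π}).IsMaximal) {q s : ℕ} (K d : ℕ)
    (hq : q = Nat.card (R ⧸ Ideal.span {π})) (hs : s = nilpotencyClass π) (hs0 : 0 < s) :
    freeProportion π (2 * K + d) K =
      (∑' m : Fin (s - 1) → ℕ, if ∑ i, m i ≤ K then typeWeight (1 / q) s K d m else 0)⁻¹ := by
  have h := (ncard_typeSubmodules_eq (d := d) hR hπ hq hs hs0 (lam := fun _ : Fin K => s)
    (fun _ _ _ => le_rfl) fun _ => ⟨hs0, le_rfl⟩).2
  have h' : ((freeRankSubmodules π (2 * K + d) K).ncard : ℝ) ≠ 0 := by exact_mod_cast h.ne'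
  rw [freeProportion, ncard_rankSubmodules_eq hR hπ K d hq hs hs0, div_mul_cancel_left₀ h']

theorem mainTheorem7 {R : Type*} [Ring R] [Finite R] (hR : IsChainRing R)
    (π : R) (hπ : (Ideal.span {π}).IsMaximal)
    (q s : ℕ) (hq : q = Nat.card (R ⧸ Ideal.span {π})) (hs : s = nilpotencyClass π)
    (R' : ℚ) (hR'_pos : 0 < R') (hR'_le : R' ≤ 1 / 2) :
    Summable (agiTerm (1 / (q : ℝ)) s) ∧
    ∃ d : ℝ,
      (∀ n K : ℕ → ℕ, Tendsto n atTop atTop → (∀ j, (K j : ℚ) = R' * (n j : ℚ)) →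
        Tendsto (fun j => freeProportion π (n j) (K j)) atTop (𝓝 d)) ∧
      (AGI (1 / (q : ℝ)) s)⁻¹ ≤ d ∧
      (R' < 1 / 2 → d = 1) := by
  have hq2 : 2 ≤ q := hq ▸ two_le_card_quotient hπ
  have hx0 : (0 : ℝ) ≤ 1 / q := by positivity
  have hx : 1 / (q : ℝ) ≤ 1 / 2 := one_div_le_one_div_of_le two_pos (by exact_mod_cast hq2)
  have hs0 : 0 < s := hs ▸ IsChainRing.nilpotencyClass_generator_pos hR hπ
  have hAGI := one_le_AGI hx0 hx s
  have hK : ∀ n K : ℕ → ℕ, Tendsto n atTop atTop → (∀ j, (K j : ℚ) = R' * (n j : ℚ)) →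
      Tendsto K atTop atTop := by
    intro n K hn hKn
    rw [← tendsto_natCast_atTop_iff (R := ℚ)]
    simp only [hKn]
    exact (tendsto_natCast_atTop_atTop.comp hn).const_mul_atTop hR'_pos
  have hsplit : ∀ n K : ℕ → ℕ, (∀ j, (K j : ℚ) = R' * (n j : ℚ)) →
      ∀ j, n j = 2 * K j + (n j - 2 * K j) := by
    intro n K hKn j
    have : (2 * K j : ℚ) ≤ n j := by
      rw [hKn]
      nlinarith [Nat.cast_nonneg (α := ℚ) (n j)]
    have : 2 * K j ≤ n j := by exact_mod_cast this
    omega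
  have hprop : ∀ n K : ℕ → ℕ, (∀ j, (K j : ℚ) = R' * (n j : ℚ)) → ∀ j,
      freeProportion π (n j) (K j) = (∑' m : Fin (s - 1) → ℕ, if ∑ i, m i ≤ K j then
        typeWeight (1 / q) s (K j) (n j - 2 * K j) m else 0)⁻¹ := by
    intro n K hKn j
    rw [← freeProportion_eq_inv_tsum hR hπ (K j) (n j - 2 * K j) hq hs hs0, ← hsplit n K hKn j]
  refine ⟨summable_agiTerm hx0 hx s, ?_⟩
  -- Below 1/2 the excess `n - 2K = (1 - 2R')n` is unbounded and the inequality reduces to `1 ≤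
  -- AGI`; at 1/2 the excess vanishes identically.
  rcases hR'_le.lt_or_eq with hlt | heq
  · refine ⟨1, fun n K hn hKn => ?_, inv_le_one_of_one_le₀ hAGI, fun _ => rfl⟩
    simp only [hprop n K hKn]
    have hd : Tendsto (fun j => n j - 2 * K j) atTop atTop := by
      rw [← tendsto_natCast_atTop_iff (R := ℚ)]
      have h1 : ∀ j, ((n j - 2 * K j : ℕ) : ℚ) = (1 - 2 * R') * n j := by
        intro j
        have h2 := congrArg (Nat.cast : ℕ → ℚ) (hsplit n K hKn j)
        rw [Nat.cast_add, Nat.cast_mul, hKn] at h2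
        push_cast at h2 ⊢
        linarith
      simp only [h1]
      exact (tendsto_natCast_atTop_atTop.comp hn).const_mul_atTop (by linarith)
    have h2 := (tendsto_tsum_typeWeight_one hx0 hx s (hK n K hn hKn) hd).inv₀ one_ne_zero
    rwa [inv_one] at h2
  · refine ⟨(AGI (1 / (q : ℝ)) s)⁻¹, fun n K hn hKn => ?_, le_rfl, fun h => absurd heq h.ne⟩
    simp only [hprop n K hKn]
    refine (tendsto_tsum_typeWeight_AGI hx0 hx s (hK n K hn hKn) fun j => ?_).inv₀ (by linarith)
    have h1 : (2 * K j : ℚ) = n j := by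
      rw [hKn, heq]
      ring
    have h2 : 2 * K j = n j := by exact_mod_cast h1
    omega
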